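/- Let $k$ be a field of characteristic $0$. Algebras are $k$-vector spaces with a bilinear multiplication (not assumed associative or unital). An algebra is power associative if any two nonassociative monomials of the same degree in one variable $x$ take equal values on it: $x(xx)=(xx)x$, $x(x(xx))=x((xx)x)=(x(xx))x=((xx)x)x=(xx)(xx)$, and so on. Let $\Theta$ be the variety of all power associative algebras over $k$, let $X_0$ be a countably infinite set of symbols containing $x_1,x_2$, and let $\Theta^0$ be the category whose objects are the free algebras $F(X)$ of $\Theta$ on the finite subsets $X\subset X_0$ and whose morphisms are all algebra homomorphisms. Let $\mathfrak A$ be the group of all (strictly invertible) automorphisms of the category $\Theta^0$, and $\mathfrak Y$ the normal subgroup of inner automorphisms, i.e. those isomorphic as functors to the identity functor. An automorphism $\Phi$ of $\Theta^0$ is strongly stable if it fixes all objects and there are bijections $s_X:F(X)\to F(X)$ with $s_X|_X=\mathrm{id}_X$ such that $\Phi(\psi)=s_Y\,\psi\, s_X^{-1}$ for every $\psi:F(X)\to F(Y)$. A system of words $W$ consists of $w_0\in F(\varnothing)$, $w_\lambda\in F(x_1)$ for each $\lambda\in k$, and $w_+,w_\cdot\in F(x_1,x_2)$; for $H\in\Theta$,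 let $H_W^*$ be the set $H$ in which the operations $0$, multiplication by each scalar $\lambda$, $+$ and $\cdot$ are replaced by the operations obtained by evaluating $w_0,w_\lambda,w_+,w_\cdot$ in $H$. Call $W$ admissible if for every finite $X\subset X_0$ there is an isomorphism $\sigma_X:F(X)\to F(X)_W^*$ with $\sigma_X|_X=\mathrm{id}_X$. Say that $\Phi$ corresponds to $W$ if there are bijections $s_X$ as in the definition of strong stability of $\Phi$ that are isomorphisms $F(X)\to F(X)_W^*$ for all $X$. Then: (1) $\mathfrak A/\mathfrak Y\cong k^*\rtimes \mathrm{Aut}\,k$, where the group $\mathrm{Aut}\,k$ of field automorphisms of $k$ acts on $k^*$ in the natural way. (2) Each strongly stable automorphism of $\Theta^0$ corresponds to exactly one system of words $W$, and for each admissible system of words there is exactly one automorphism of $\Theta^0$ that corresponds to it. (3) A system of words is admissible if and only if there are $\varphi\in\mathrm{Aut}\,k$ and $\alpha_{12},\alpha_{21}\in k$ with $\alpha_{12}\neq\pm\alpha_{21}$ such that $w_0=0$, $w_\lambda=\varphi(\lambda)x_1$ for all $\lambda\in k$, $w_+=x_1+x_2$ and $w_\cdot=\alpha_{12}x_1x_2+\alpha_{21}x_2x_1$.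 (4) An automorphism of $\Theta^0$ that corresponds to the system of words in (3) given by $\varphi,\alpha_{12},\alpha_{21}$ is inner if and only if $\alpha_{21}=0$ and $\varphi=\mathrm{id}_k$. -/

import Mathlib

open CategoryTheory

universe u v w

noncomputable section

namespace PowAssoc

/-! ### Power associative algebras -/

/-- The value at `h` of a nonassociative monomial `t` in one variable. -/
def monomialEval {H : Type*} [Mul H] (t : FreeMagma Unit) (h : H) : H :=
  FreeMagma.lift (fun _ => h) t

/-- Power associativity: any two nonassociative monomials of the same degree in one variable
agree identically, that is `x (x x) = (x x) x`, `x (x (x x)) = x ((x x) x) = (x (x x)) x =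
((x x) x) x = (x x) (x x)`, and so on in every degree. -/
class IsPowerAssociative (H : Type*) [Mul H] : Prop where
  monomialEval_eq : ∀ (s t : FreeMagma Unit), s.length = t.length →
    ∀ h : H, monomialEval s h = monomialEval t h

theorem map_monomialEval {A B F : Type*} [Mul A] [Mul B] [FunLike F A B] [MulHomClass F A B]
    (f : F) (t : FreeMagma Unit) (a : A) : f (monomialEval t a) = monomialEval t (f a) := by
  induction t with
  | ih1 x => simp [monomialEval]
  | ih2 x y hx hy =>
    simp only [monomialEval, map_mul] at hx hy ⊢
    rw [hx, hy]

/-! ### Free power associative algebras -/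

/-- The relation on the free nonassociative algebra (without unit) whose generated equivalence
relation is the least congruence imposing power associativity. -/
inductive FreePA.Rel (k : Type u) [Field k] (X : Type v) :
    FreeNonUnitalNonAssocAlgebra k X → FreeNonUnitalNonAssocAlgebra k X → Prop
  | pow_assoc (s t : FreeMagma Unit) (h : s.length = t.length)
      (a : FreeNonUnitalNonAssocAlgebra k X) :
      FreePA.Rel k X (monomialEval s a) (monomialEval t a)
  | smul (c : k) {a b : FreeNonUnitalNonAssocAlgebra k X} :
      FreePA.Rel k X a b → FreePA.Rel k X (c • a) (c • b)
  | add_right {a b : FreeNonUnitalNonAssocAlgebra k X} (c : FreeNonUnitalNonAssocAlgebra k X) :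
      FreePA.Rel k X a b → FreePA.Rel k X (a + c) (b + c)
  | mul_left (a : FreeNonUnitalNonAssocAlgebra k X) {b c : FreeNonUnitalNonAssocAlgebra k X} :
      FreePA.Rel k X b c → FreePA.Rel k X (a * b) (a * c)
  | mul_right {a b : FreeNonUnitalNonAssocAlgebra k X} (c : FreeNonUnitalNonAssocAlgebra k X) :
      FreePA.Rel k X a b → FreePA.Rel k X (a * c) (b * c)

/-- The free power associative `k`-algebra (without unit) on the set `X`. -/
def FreePA (k : Type u) [Field k] (X : Type v) : Type (max u v) :=
  Quot (FreePA.Rel k X)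

namespace FreePA

variable {k : Type u} [Field k] {X : Type v}

theorem Rel.add_left (a : FreeNonUnitalNonAssocAlgebra k X)
    {b c : FreeNonUnitalNonAssocAlgebra k X} (h : Rel k X b c) : Rel k X (a + b) (a + c) := by
  rw [add_comm a b, add_comm a c]
  exact h.add_right _

theorem Rel.neg {a b : FreeNonUnitalNonAssocAlgebra k X} (h : Rel k X a b) :
    Rel k X (-a) (-b) := by
  simpa only [neg_one_smul] using h.smul (-1)

theorem Rel.sub_left (a : FreeNonUnitalNonAssocAlgebra k X)
    {b c : FreeNonUnitalNonAssocAlgebra k X} (h : Rel k X b c) : Rel k X (a - b) (a - c) := by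
  simpa only [sub_eq_add_neg] using h.neg.add_left a

theorem Rel.sub_right {a b : FreeNonUnitalNonAssocAlgebra k X}
    (c : FreeNonUnitalNonAssocAlgebra k X) (h : Rel k X a b) : Rel k X (a - c) (b - c) := by
  simpa only [sub_eq_add_neg] using h.add_right (-c)

instance : Zero (FreePA k X) where zero := Quot.mk _ 0

instance : Add (FreePA k X) where
  add := Quot.map₂ (· + ·) (fun _ _ _ => Rel.add_left _) fun _ _ _ => Rel.add_right _

instance : Neg (FreePA k X) where neg := Quot.map Neg.neg fun _ _ => Rel.neg

instance : Sub (FreePA k X) where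
  sub := Quot.map₂ Sub.sub (fun _ _ _ => Rel.sub_left _) fun _ _ _ => Rel.sub_right _

instance : Mul (FreePA k X) where
  mul := Quot.map₂ (· * ·) (fun _ _ _ => Rel.mul_left _) fun _ _ _ => Rel.mul_right _

instance : SMul k (FreePA k X) where smul c := Quot.map (c • ·) fun _ _ => Rel.smul c

instance : SMul ℕ (FreePA k X) where
  smul n := Quot.map (n • ·) fun a b h => by
    simpa only [Nat.cast_smul_eq_nsmul] using h.smul (n : k)

instance : SMul ℤ (FreePA k X) where
  smul n := Quot.map (n • ·) fun a b h => by
    simpa only [Int.cast_smul_eq_zsmul] using h.smul (n : k)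

instance : NonUnitalNonAssocRing (FreePA k X) :=
  Function.Surjective.nonUnitalNonAssocRing (Quot.mk _) Quot.mk_surjective rfl
    (fun _ _ => rfl) (fun _ _ => rfl) (fun _ => rfl) (fun _ _ => rfl) (fun _ _ => rfl)
    fun _ _ => rfl

instance : Module k (FreePA k X) :=
  Function.Surjective.module k ⟨⟨Quot.mk (Rel k X), rfl⟩, fun _ _ => rfl⟩
    Quot.mk_surjective fun _ _ => rfl

variable (k X) in
/-- The quotient map from the free nonassociative algebra. -/
def mk : FreeNonUnitalNonAssocAlgebra k X →ₙₐ[k] FreePA k X where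
  toFun := Quot.mk (Rel k X)
  map_smul' _ _ := rfl
  map_zero' := rfl
  map_add' _ _ := rfl
  map_mul' _ _ := rfl

theorem mk_surjective : Function.Surjective (mk k X) := Quot.mk_surjective

instance : IsScalarTower k (FreePA k X) (FreePA k X) where
  smul_assoc c := by
    rintro ⟨a⟩ ⟨b⟩
    exact congrArg (mk k X) (smul_mul_assoc c a b)

instance : SMulCommClass k (FreePA k X) (FreePA k X) where
  smul_comm c := by
    rintro ⟨a⟩ ⟨b⟩
    exact congrArg (mk k X) (mul_smul_comm c a b).symm

instance : IsPowerAssociative (FreePA k X) where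
  monomialEval_eq s t h a := by
    obtain ⟨a, rfl⟩ := mk_surjective a
    rw [← map_monomialEval (mk k X), ← map_monomialEval (mk k X)]
    exact Quot.sound (Rel.pow_assoc s t h a)

variable (k) in
/-- The free generators. -/
def of (x : X) : FreePA k X := mk k X (FreeNonUnitalNonAssocAlgebra.of k x)

variable {H : Type w} [NonUnitalNonAssocRing H] [Module k H] [IsScalarTower k H H]
  [SMulCommClass k H H]

theorem lift_rel [IsPowerAssociative H] (f : X → H) (a b : FreeNonUnitalNonAssocAlgebra k X)
    (h : Rel k X a b) : FreeNonUnitalNonAssocAlgebra.lift k f a =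
      FreeNonUnitalNonAssocAlgebra.lift k f b := by
  induction h with
  | pow_assoc s t h a =>
    rw [map_monomialEval, map_monomialEval]
    exact IsPowerAssociative.monomialEval_eq s t h _
  | smul c _ ih => rw [map_smul, map_smul, ih]
  | add_right c _ ih => rw [map_add, map_add, ih]
  | mul_left a _ ih => rw [map_mul, map_mul, ih]
  | mul_right c _ ih => rw [map_mul, map_mul, ih]

variable (k) in
/-- The homomorphism from the free power associative algebra that extends a given map on the
generators. -/
def lift [IsPowerAssociative H] (f : X → H) : FreePA k X →ₙₐ[k] H where
  toFun := Quot.lift (FreeNonUnitalNonAssocAlgebra.lift k f) (lift_rel f)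
  map_smul' c := by rintro ⟨a⟩; exact map_smul (FreeNonUnitalNonAssocAlgebra.lift k f) c a
  map_zero' := map_zero (FreeNonUnitalNonAssocAlgebra.lift k f)
  map_add' := by rintro ⟨a⟩ ⟨b⟩; exact map_add (FreeNonUnitalNonAssocAlgebra.lift k f) a b
  map_mul' := by rintro ⟨a⟩ ⟨b⟩; exact map_mul (FreeNonUnitalNonAssocAlgebra.lift k f) a b

@[simp]
theorem lift_of [IsPowerAssociative H] (f : X → H) (x : X) : lift k f (of k x) = f x :=
  FreeNonUnitalNonAssocAlgebra.lift_of_apply k f x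

theorem hom_ext {f g : FreePA k X →ₙₐ[k] H} (h : ∀ x, f (of k x) = g (of k x)) : f = g := by
  have h' : f.comp (mk k X) = g.comp (mk k X) :=
    FreeNonUnitalNonAssocAlgebra.hom_ext k fun x => h x
  ext a
  obtain ⟨a, rfl⟩ := mk_surjective a
  exact DFunLike.congr_fun h' a

end FreePA

/-! ### The category of finitely generated free algebras -/

/-- Objects of the category `Θ⁰`: the free power associative algebras `F(X)` on the finite
subsets `X` of the countable set of symbols `x₀, x₁, x₂, …`, indexed by `ℕ`. -/
structure Theta0 (k : Type u) where
  /-- The finite set of free generators. -/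
  gens : Finset ℕ

/-- The free algebra `F(X)` on a finite set of symbols. -/
abbrev F (k : Type u) [Field k] (X : Finset ℕ) : Type u := FreePA k X

variable {k : Type u} [Field k]

/-- Morphisms of `Θ⁰` are all algebra homomorphisms. -/
instance : Category.{u} (Theta0 k) where
  Hom A B := F k A.gens →ₙₐ[k] F k B.gens
  id A := NonUnitalAlgHom.id k (F k A.gens)
  comp f g := NonUnitalAlgHom.comp g f

/-- A morphism of `Θ⁰` as an algebra homomorphism. -/
def Theta0.algHom {A B : Theta0 k} (f : A ⟶ B) : F k A.gens →ₙₐ[k] F k B.gens := f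

/-! ### Inner automorphisms -/

/-- The inner automorphisms of a category `C`: the (strictly invertible) functors `C ⥤ C` that
are isomorphic, as functors, to the identity. -/
def innerAut (C : Type v) [Category.{w} C] : Subgroup (Aut (Cat.of C)) where
  carrier := {Φ | Nonempty (𝟭 C ≅ Φ.hom.toFunctor)}
  one_mem' := ⟨Iso.refl (𝟭 C)⟩
  mul_mem' := by
    rintro f g ⟨a⟩ ⟨b⟩
    exact ⟨a ≪≫ Functor.isoWhiskerRight b f.hom.toFunctor⟩
  inv_mem' := by
    rintro f ⟨a⟩
    have h : f.hom.toFunctor ⋙ f.inv.toFunctor = 𝟭 C :=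
      congrArg Cat.Hom.toFunctor f.hom_inv_id
    exact ⟨(Functor.isoWhiskerRight a f.inv.toFunctor ≪≫ eqToIso h).symm⟩

instance (C : Type v) [Category.{w} C] : (innerAut C).Normal where
  conj_mem := by
    rintro n ⟨a⟩ g
    have h : g.inv.toFunctor ⋙ g.hom.toFunctor = 𝟭 C :=
      congrArg Cat.Hom.toFunctor g.inv_hom_id
    exact ⟨eqToIso h.symm ≪≫ Functor.isoWhiskerLeft g.inv.toFunctor
      (Functor.isoWhiskerRight a g.hom.toFunctor)⟩

/-! ### Strongly stable automorphisms -/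

/-- `Φ` fixes all objects of `Θ⁰` and acts on morphisms by `ψ ↦ s_E ψ s_D⁻¹`, where the
bijections `s_X : F(X) → F(X)` fix the free generators. -/
structure ActsBy (Φ : Aut (Cat.of (Theta0 k))) (s : ∀ X : Finset ℕ, F k X ≃ F k X) : Prop where
  obj_eq : ∀ A : Theta0 k, Φ.hom.toFunctor.obj A = A
  map_eq : ∀ (D E : Theta0 k) (ψ : D ⟶ E) (a : F k D.gens),
    Theta0.algHom
        (eqToHom (obj_eq D).symm ≫ Φ.hom.toFunctor.map ψ ≫ eqToHom (obj_eq E) : D ⟶ E) a =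
      s E.gens (Theta0.algHom ψ ((s D.gens).symm a))
  gens_eq : ∀ (X : Finset ℕ) (x : X), s X (FreePA.of k x) = FreePA.of k x

/-- Strongly stable automorphisms of `Θ⁰`. -/
def IsStronglyStable (Φ : Aut (Cat.of (Theta0 k))) : Prop :=
  ∃ s : ∀ X : Finset ℕ, F k X ≃ F k X, ActsBy Φ s

/-! ### Systems of words and verbal operations -/

variable (k) in
/-- A system of words for the signature of one-sorted linear algebras over `k`: a word for `0`, a
word in `x₁` for the multiplication by each scalar, and words in `x₁, x₂` for the addition and
the multiplication. -/
structure WordSystem where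
  zero : F k ∅
  smul : k → F k {1}
  add : F k {1, 2}
  mul : F k {1, 2}

namespace WordSystem

variable {H : Type w} [NonUnitalNonAssocRing H] [Module k H] [IsScalarTower k H H]
  [SMulCommClass k H H] [IsPowerAssociative H]

variable (H) in
/-- The verbal operation on `H` defined by the word for `0`. -/
def opZero (W : WordSystem k) : H := FreePA.lift k (fun _ => 0) W.zero

/-- The verbal operation `h ↦ w_c(h)` defined by the word for the multiplication by `c`. -/
def opSMul (W : WordSystem k) (c : k) (h : H) : H := FreePA.lift k (fun _ => h) (W.smul c)

/-- The verbal operation `(h₁, h₂) ↦ w_+(h₁, h₂)` defined by the word for the addition. -/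
def opAdd (W : WordSystem k) (h₁ h₂ : H) : H :=
  FreePA.lift k (fun i => if i.1 = 1 then h₁ else h₂) W.add

/-- The verbal operation `(h₁, h₂) ↦ w_·(h₁, h₂)` defined by the word for the multiplication. -/
def opMul (W : WordSystem k) (h₁ h₂ : H) : H :=
  FreePA.lift k (fun i => if i.1 = 1 then h₁ else h₂) W.mul

/-- The bijection `σ` is an isomorphism from `H` to `H_W^*`, the set `H` with the original
operations replaced by the verbal operations of `W`. -/
structure IsIsoToVerbal (W : WordSystem k) (σ : H ≃ H) : Prop where
  map_zero : σ 0 = W.opZero H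
  map_smul : ∀ (c : k) (a : H), σ (c • a) = W.opSMul c (σ a)
  map_add : ∀ a b : H, σ (a + b) = W.opAdd (σ a) (σ b)
  map_mul : ∀ a b : H, σ (a * b) = W.opMul (σ a) (σ b)

/-- A system of words is admissible if for every finite `X` there is an isomorphism
`F(X) → F(X)_W^*` that fixes the free generators. -/
def IsAdmissible (W : WordSystem k) : Prop :=
  ∀ X : Finset ℕ, ∃ σ : F k X ≃ F k X,
    W.IsIsoToVerbal σ ∧ ∀ x : X, σ (FreePA.of k x) = FreePA.of k x

/-- The system `w_0 = 0`, `w_c = φ(c) x₁`, `w_+ = x₁ + x₂`, `w_· = α₁₂ x₁ x₂ + α₂₁ x₂ x₁`. -/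
def standard (φ : RingAut k) (α₁₂ α₂₁ : k) : WordSystem k where
  zero := 0
  smul c := φ c • FreePA.of k ⟨1, by simp⟩
  add := FreePA.of k ⟨1, by simp⟩ + FreePA.of k ⟨2, by simp⟩
  mul := α₁₂ • (FreePA.of k ⟨1, by simp⟩ * FreePA.of k ⟨2, by simp⟩) +
    α₂₁ • (FreePA.of k ⟨2, by simp⟩ * FreePA.of k ⟨1, by simp⟩)

end WordSystem

/-- The strongly stable automorphism `Φ` corresponds to the system of words `W`: the bijections
through which `Φ` acts are the isomorphisms `F(X) → F(X)_W^*` fixing the free generators. -/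
def Corresponds (Φ : Aut (Cat.of (Theta0 k))) (W : WordSystem k) : Prop :=
  ∃ s : ∀ X : Finset ℕ, F k X ≃ F k X, ActsBy Φ s ∧ ∀ X : Finset ℕ, W.IsIsoToVerbal (s X)

variable (k) in
/-- The natural action of the group of field automorphisms of `k` on the multiplicative
group `kˣ`. -/
def autActionUnits : RingAut k →* MulAut kˣ where
  toFun φ := Units.mapEquiv φ.toMulEquiv
  map_one' := by ext; rfl
  map_mul' _ _ := by ext; rfl

end PowAssoc

end

noncomputable section

namespace PowAssoc

/-! ### Structure of the free algebras -/

namespace FreePA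

section Basic

variable {k : Type u} [Field k] {X : Type v}

/-! The bijections `s_X` of a strongly stable automorphism are recovered from it by evaluating at
`x₁` the images of the homomorphisms `x₁ ↦ a`, and the words are the values of `s` at `c x₁`, `x₁ +
x₂` and `x₁ x₂`. Everything thus rests on classifying admissible systems.

The free algebra on `x₁` embeds into the polynomials as those without constant term
(`toPoly_injective`), so an element invertible under substitution is a multiple of `x₁`. Hence `w_c
= φ(c) x₁` with `φ` multiplicative and injective. In characteristic zero no power of `φ(2)` other
than the first equals `φ(2)`, so compatibility with doubling forces `w_+` to be linear and `w_·` to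
have degree one in each variable (`mem_span_monDegree_eq_one`). Injectivity then excludes `α = ±β`,
since otherwise the new product would be commutative or anticommutative. Conversely, the product `α
ab + β ba` multiplies each power of degree `n` by `(α + β)^(n-1)`, so it stays power associative
(`Twisted.monomialEval_up`); the universal property yields a twisted endomorphism, invertible when
`α ≠ ±β`.

A natural isomorphism from the identity to the automorphism of a twist `s` differs from `s` by a
substitution invertible in the free algebra on `x₁`, that is, by a scalar. Multiplicativity of its
components then leaves only `β = 0` and `φ = 1` (`ActsBy.mem_innerAut_iff`).

In the coordinates `(α + β, α - β)` twists compose coordinatewise up to the action of `φ`, and the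
inner ones have equal coordinates and `φ = 1`. The class of a twist is therefore given by `(α +
β)/(α - β)` and `φ`, and the twists with `α - β = 1` form a section. An arbitrary automorphism
preserves rank one, hence is conjugation by bijections taking free generators to free generators
(`exists_natural_bijections`, `exists_isTwist_eq_of`), and so is isomorphic to one given by a twist.
-/

/-- Induction principle for the free power associative algebra. -/
theorem induction {p : FreePA k X → Prop} (of : ∀ x, p (of k x)) (zero : p 0)
    (add : ∀ a b, p a → p b → p (a + b)) (smul : ∀ (c : k) a, p a → p (c • a))
    (mul : ∀ a b, p a → p b → p (a * b)) (a : FreePA k X) : p a := by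
  obtain ⟨a, rfl⟩ := mk_surjective a
  have hm : ∀ m : FreeMagma X, p (mk k X (MonoidAlgebra.ofMagma k _ m)) := by
    intro m
    induction m with
    | ih1 x => exact of x
    | ih2 x y hx hy =>
      rw [map_mul, map_mul]
      exact mul _ _ hx hy
  induction a using MonoidAlgebra.induction_linear with
  | zero => exact (map_zero (mk k X)).symm ▸ zero
  | add f g hf hg => exact (map_add (mk k X) f g).symm ▸ add _ _ hf hg
  | single m c =>
    have h := smul c _ (hm m)
    rw [← map_smul] at h
    simpa [MonoidAlgebra.ofMagma] using h

variable (k) in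
/-- The value of a nonassociative monomial in the free algebra. -/
def mon : FreeMagma X →ₙ* FreePA k X := FreeMagma.lift (of k)

@[simp]
theorem mon_of (x : X) : mon k (FreeMagma.of x) = of k x := rfl

theorem span_mon : Submodule.span k (Set.range (mon k : FreeMagma X → FreePA k X)) = ⊤ := by
  refine (Submodule.eq_top_iff'.2 fun a => ?_)
  induction a using induction with
  | of x => exact Submodule.subset_span ⟨_, mon_of x⟩
  | zero => exact zero_mem _
  | add a b ha hb => exact add_mem ha hb
  | smul c a ha => exact Submodule.smul_mem _ c ha
  | mul a b ha hb =>
    induction ha using Submodule.span_induction with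
    | mem a ha =>
      obtain ⟨s, rfl⟩ := ha
      induction hb using Submodule.span_induction with
      | mem b hb =>
        obtain ⟨t, rfl⟩ := hb
        exact Submodule.subset_span ⟨s * t, map_mul _ _ _⟩
      | zero => rw [mul_zero]; exact zero_mem _
      | add b c _ _ hb hc => rw [mul_add]; exact add_mem hb hc
      | smul c b _ hb => rw [mul_smul_comm]; exact Submodule.smul_mem _ c hb
    | zero => rw [zero_mul]; exact zero_mem _
    | add b c _ _ hb hc => rw [add_mul]; exact add_mem hb hc
    | smul c b _ hb => rw [smul_mul_assoc]; exact Submodule.smul_mem _ c hb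

instance [IsEmpty X] : Subsingleton (FreePA k X) := by
  refine subsingleton_of_forall_eq 0 fun a => ?_
  induction a using induction with
  | of x => exact isEmptyElim x
  | zero => rfl
  | add a b ha hb => rw [ha, hb, add_zero]
  | smul c a ha => rw [ha, smul_zero]
  | mul a b ha hb => rw [ha, zero_mul]

end Basic

end FreePA

theorem monomialEval_eq_pow {M : Type*} [Monoid M] (t : FreeMagma Unit) (a : M) :
    monomialEval t a = a ^ t.length := by
  induction t with
  | ih1 x => simp [monomialEval]
  | ih2 x y hx hy =>
    rw [monomialEval, map_mul]
    change monomialEval x a * monomialEval y a = _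
    rw [hx, hy, ← pow_add]
    rfl

/-- This makes matrix and polynomial algebras legitimate targets of `lift`; they serve to separate
elements of the free algebras. -/
instance (M : Type*) [Monoid M] : IsPowerAssociative M where
  monomialEval_eq s t h a := by rw [monomialEval_eq_pow, monomialEval_eq_pow, h]

namespace FreePA

variable {k : Type u} [Field k] {X : Type v}

/-- The products of two distinct free generators in the two orders are linearly independent. -/
theorem smul_mul_add_smul_mul_eq_zero {x y : X} (hxy : x ≠ y) {a b : k}
    (h : a • (of k x * of k y) + b • (of k y * of k x) = 0) : a = 0 ∧ b = 0 := by
  classical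
  -- With `x ↦ E₁₂` and `y ↦ E₂₁` the two products become `E₁₁` and `E₂₂`, so the diagonal entries
  -- read off `a` and `b`.
  let f : FreePA k X →ₙₐ[k] Matrix (Fin 2) (Fin 2) k :=
    lift k fun z => if z = x then !![0, 1; 0, 0] else !![0, 0; 1, 0]
  have h' := congrArg f h
  simp only [map_add, map_smul, map_mul, map_zero, f, lift_of, if_pos, if_neg hxy.symm] at h'
  have h0 := congrFun (congrFun h' 0) 0
  have h1 := congrFun (congrFun h' 1) 1
  simpa using And.intro h0 h1

/-- If `T` is a linear endomorphism, then an eigenvector of `T` that lies in the span of a family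
of eigenvectors lies in the span of those with the same eigenvalue. -/
theorem mem_span_of_eigenvectors {V ι : Type*} [AddCommGroup V] [Module k V] (T : Module.End k V)
    (v : ι → V) (e : ι → k) (hv : ∀ i, T (v i) = e i • v i) (I : Set ι) {c : k} {w : V}
    (hw : w ∈ Submodule.span k (v '' I)) (hc : T w = c • w) :
    w ∈ Submodule.span k (v '' {i ∈ I | e i = c}) := by
  have hu : I = {i ∈ I | e i = c} ∪ {i ∈ I | e i ≠ c} := by
    ext i; simp only [Set.mem_union, Set.mem_ofPred_eq]; tauto
  rw [hu, Set.image_union, Submodule.span_union, Submodule.mem_sup] at hw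
  obtain ⟨a, ha, b, hb, rfl⟩ := hw
  have ha' : a ∈ T.eigenspace c := by
    refine Submodule.span_le.2 ?_ ha
    rintro _ ⟨i, ⟨-, rfl⟩, rfl⟩
    exact Module.End.mem_eigenspace_iff.2 (hv i)
  have hb' : b ∈ ⨆ μ, ⨆ (_ : μ ≠ c), T.eigenspace μ := by
    refine Submodule.span_le.2 ?_ hb
    rintro _ ⟨i, ⟨-, hne⟩, rfl⟩
    exact Submodule.mem_iSup_of_mem (e i) (Submodule.mem_iSup_of_mem hne
      (Module.End.mem_eigenspace_iff.2 (hv i)))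
  -- The component `b` lies both in the eigenspace of `c` and in the sum of the others, so
  -- independence of eigenspaces kills it.
  have hb'' : b ∈ T.eigenspace c := by
    have := sub_mem (Module.End.mem_eigenspace_iff.2 hc : a + b ∈ T.eigenspace c) ha'
    simpa using this
  have h0 : b = 0 := by
    have := (Module.End.eigenspaces_iSupIndep T c).le_bot ⟨hb'', hb'⟩
    simpa using this
  rw [h0, add_zero]
  exact ha

/-! ### Gradings and homogeneous elements -/

/-- The degree of a nonassociative monomial in which the variable `x` has degree `d x`. -/
def monDegree (d : X → ℕ) : FreeMagma X → ℕ
  | .of x => d x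
  | .mul s t => monDegree d s + monDegree d t

theorem monDegree_mul (d : X → ℕ) (s t : FreeMagma X) :
    monDegree d (s * t) = monDegree d s + monDegree d t := rfl

theorem lift_pow_smul_mon (a : k) (d : X → ℕ) (t : FreeMagma X) :
    lift k (fun x => a ^ d x • of k x) (mon k t) = a ^ monDegree d t • mon k t := by
  induction t with
  | ih1 x => simp [monDegree]
  | ih2 s t hs ht =>
    rw [map_mul, map_mul, hs, ht, monDegree_mul, pow_add, smul_mul_smul_comm]

/-- If a rescaling of the generators multiplies `w` by `a`, where `a` is not a root of unity,
then `w` is homogeneous of degree `1`. -/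
theorem mem_span_monDegree_eq_one {a : k} (ha : ∀ n : ℕ, a ^ n = a → n = 1) (d : X → ℕ)
    (I : Set (FreeMagma X)) {w : FreePA k X} (hw : w ∈ Submodule.span k (mon k '' I))
    (h : lift k (fun x => a ^ d x • of k x) w = a • w) :
    w ∈ Submodule.span k (mon k '' {t ∈ I | monDegree d t = 1}) := by
  refine Submodule.span_mono (Set.image_mono ?_) (mem_span_of_eigenvectors
    (lift k (fun x => a ^ d x • of k x) : FreePA k X →ₗ[k] FreePA k X) (mon k)
    (fun t => a ^ monDegree d t) (lift_pow_smul_mon a d) I hw h)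
  exact fun t ht => ⟨ht.1, ha _ ht.2⟩

theorem exists_of_monDegree_one {t : FreeMagma X} (h : monDegree (fun _ => 1) t = 1) :
    ∃ x, t = FreeMagma.of x := by
  have hpos : ∀ t : FreeMagma X, 0 < monDegree (fun _ => 1) t := by
    intro t
    induction t with
    | ih1 x => exact one_pos
    | ih2 s t hs ht => rw [monDegree_mul]; omega
  cases t with
  | of x => exact ⟨x, rfl⟩
  | mul s t =>
    have h1 := hpos s
    have h2 := hpos t
    simp only [monDegree] at h
    omega

/-! ### The free algebra on one generator -/

section One

variable (k X) in
/-- The embedding of the free algebra on one generator into the polynomials. -/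
def toPoly : FreePA k X →ₙₐ[k] Polynomial k := lift k fun _ => Polynomial.X

theorem mon_eq_monomialEval [Unique X] (t : FreeMagma X) :
    mon k t = monomialEval (FreeMagma.map (fun _ => ()) t) (of k (default : X)) := by
  induction t with
  | ih1 x => rw [mon_of, Unique.eq_default x]; rfl
  | ih2 x y hx hy => rw [map_mul, hx, hy, map_mul]; simp [monomialEval]

theorem length_map_unit (t : FreeMagma X) :
    (FreeMagma.map (fun _ => ()) t).length = t.length := by
  induction t with
  | ih1 x => rfl
  | ih2 x y hx hy => rw [map_mul]; exact congrArg₂ (· + ·) hx hy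

theorem toPoly_mon [Unique X] (t : FreeMagma X) : toPoly k X (mon k t) = Polynomial.X ^ t.length := by
  rw [mon_eq_monomialEval, map_monomialEval, monomialEval_eq_pow, length_map_unit]
  simp [toPoly]

theorem mon_eq_of_length_eq [Unique X] {s t : FreeMagma X} (h : s.length = t.length) :
    mon k s = mon k t := by
  rw [mon_eq_monomialEval, mon_eq_monomialEval]
  exact IsPowerAssociative.monomialEval_eq _ _ (by rw [length_map_unit, length_map_unit, h]) _

theorem toPoly_injective [Unique X] : Function.Injective (toPoly k X) := by
  classical
  -- Monomials of equal length coincide, so sending `X ^ n` to any monomial of length `n` gives a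
  -- left inverse. The default `0` is taken only at `n = 0`.
  let g : ℕ → FreePA k X := fun n =>
    if h : ∃ t : FreeMagma X, t.length = n then mon k h.choose else 0
  let r : Polynomial k →ₗ[k] FreePA k X := (Polynomial.basisMonomials k).constr k g
  have hr : r ∘ₗ (toPoly k X : FreePA k X →ₗ[k] Polynomial k) = LinearMap.id := by
    refine LinearMap.ext_on span_mon ?_
    rintro _ ⟨t, rfl⟩
    have h : ∃ s : FreeMagma X, s.length = t.length := ⟨t, rfl⟩
    have h1 : r (Polynomial.X ^ t.length) = g t.length := by
      rw [Polynomial.X_pow_eq_monomial]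
      simpa using (Polynomial.basisMonomials k).constr_basis k g t.length
    change r (toPoly k X (mon k t)) = mon k t
    rw [toPoly_mon, h1]
    simp only [g, dif_pos h]
    exact mon_eq_of_length_eq h.choose_spec
  exact Function.LeftInverse.injective (g := r) fun a => LinearMap.congr_fun hr a

theorem mul_comm_of_unique [Unique X] (a b : FreePA k X) : a * b = b * a :=
  toPoly_injective (by rw [map_mul, map_mul, mul_comm])

theorem coeff_zero_toPoly (a : FreePA k X) : (toPoly k X a).coeff 0 = 0 := by
  induction a using induction with
  | of x => simp [toPoly]
  | zero => simp
  | add a b ha hb => simp [ha, hb]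
  | smul c a ha => simp [ha]
  | mul a b ha hb => simp [Polynomial.mul_coeff_zero, ha]

theorem toPoly_lift (p q : FreePA k X) :
    toPoly k X (lift k (fun _ => q) p) = (toPoly k X p).comp (toPoly k X q) := by
  induction p using induction with
  | of x => simp [toPoly]
  | zero => simp
  | add a b ha hb => simp [ha, hb]
  | smul c a ha => simp [ha]
  | mul a b ha hb => simp [ha, hb]

/-- In the free algebra on one generator only the multiples of the generator are invertible
under substitution. -/
theorem exists_eq_smul_of_lift_eq [Unique X] {p q : FreePA k X}
    (h : lift k (fun _ => q) p = of k (default : X)) : ∃ c : k, p = c • of k (default : X) := by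
  have h' : (toPoly k X p).comp (toPoly k X q) = Polynomial.X := by
    rw [← toPoly_lift, h]; simp [toPoly]
  -- Degrees multiply under composition, so `p` has degree one; its constant term vanishes
  -- automatically.
  have hd := congrArg Polynomial.natDegree h'
  rw [Polynomial.natDegree_comp, Polynomial.natDegree_X] at hd
  have hp : (toPoly k X p).natDegree ≤ 1 := (Nat.eq_one_of_mul_eq_one_right hd).le
  refine ⟨(toPoly k X p).coeff 1, toPoly_injective ?_⟩
  conv_lhs => rw [Polynomial.eq_X_add_C_of_natDegree_le_one hp, coeff_zero_toPoly]
  simp [toPoly, Polynomial.smul_eq_C_mul]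

end One

end FreePA

/-! ### Twisted homomorphisms -/

section Twist

variable {k : Type u} [Field k]

theorem sq_sub_sq_ne_zero {α β : k} (h₁ : α ≠ β) (h₂ : α ≠ -β) : α ^ 2 - β ^ 2 ≠ 0 := by
  have : α ^ 2 - β ^ 2 = (α - β) * (α - -β) := by ring
  rw [this]
  exact mul_ne_zero (sub_ne_zero.2 h₁) (sub_ne_zero.2 h₂)

/-- A map `s : A → B` that is a homomorphism from `A` to `B` with the action of the scalars
twisted by `φ` and the multiplication replaced by `α a b + β b a`. -/
structure IsTwist {A : Type v} {B : Type w} [NonUnitalNonAssocRing A] [Module k A]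
    [NonUnitalNonAssocRing B] [Module k B] (φ : RingAut k) (α β : k) (s : A → B) : Prop where
  map_add : ∀ a b, s (a + b) = s a + s b
  map_smul : ∀ (c : k) a, s (c • a) = φ c • s a
  map_mul : ∀ a b, s (a * b) = α • (s a * s b) + β • (s b * s a)

namespace IsTwist

variable {A B C : Type*} [NonUnitalNonAssocRing A] [Module k A]
  [NonUnitalNonAssocRing B] [Module k B] [NonUnitalNonAssocRing C] [Module k C]
  {φ φ' : RingAut k} {α β α' β' : k} {s : B → C} {t : A → B}

theorem map_zero (hs : IsTwist φ α β s) : s 0 = 0 := by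
  simpa using hs.map_smul 0 0

theorem of_algHom (f : A →ₙₐ[k] B) : IsTwist (k := k) 1 1 0 f where
  map_add := _root_.map_add f
  map_smul := _root_.map_smul f
  map_mul a b := by simp

/-- A twisted homomorphism with trivial twist is a homomorphism. -/
def toAlgHom (ht : IsTwist (k := k) 1 1 0 t) : A →ₙₐ[k] B where
  toFun := t
  map_smul' := ht.map_smul
  map_zero' := ht.map_zero
  map_add' := ht.map_add
  map_mul' a b := by simpa using ht.map_mul a b

/-- The sum and difference of the new coefficients are `φ(α' + β')(α + β)` and `φ(α' - β')(α - β)`;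
this is the source of the semidirect product. -/
theorem comp (hs : IsTwist φ α β s) (ht : IsTwist φ' α' β' t) :
    IsTwist (φ * φ') (φ α' * α + φ β' * β) (φ α' * β + φ β' * α) (s ∘ t) where
  map_add a b := by simp [ht.map_add, hs.map_add]
  map_smul c a := by simp [ht.map_smul, hs.map_smul]
  map_mul a b := by
    simp only [Function.comp_apply, ht.map_mul, hs.map_add, hs.map_smul, hs.map_mul]
    module

theorem congr (hs : IsTwist φ α β s) (h₁ : φ' = φ) (h₂ : α' = α) (h₃ : β' = β) :
    IsTwist φ' α' β' s := by
  subst h₁ h₂ h₃; exact hs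

/-- The coefficients come from inverting the matrix with rows `(α, β)` and `(β, α)`, of determinant
`α² - β²`, and then applying `φ⁻¹`. -/
theorem symm {s : B ≃ C} (hs : IsTwist φ α β s) (h₁ : α ≠ β) (h₂ : α ≠ -β) :
    IsTwist φ⁻¹ (φ⁻¹ (α / (α ^ 2 - β ^ 2))) (φ⁻¹ (-β / (α ^ 2 - β ^ 2))) s.symm := by
  have h := sq_sub_sq_ne_zero h₁ h₂
  have hφ : ∀ c, φ (φ⁻¹ c) = c := φ.apply_symm_apply
  refine ⟨fun a b => s.injective ?_, fun c a => s.injective ?_, fun a b => s.injective ?_⟩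
  · simp [hs.map_add]
  · simp [hs.map_smul]
  · simp only [hs.map_add, hs.map_smul, hs.map_mul, hφ, Equiv.apply_symm_apply, smul_add,
      smul_smul]
    have e₁ : α / (α ^ 2 - β ^ 2) * α + -β / (α ^ 2 - β ^ 2) * β = 1 := by
      field_simp; ring
    have e₂ : α / (α ^ 2 - β ^ 2) * β + -β / (α ^ 2 - β ^ 2) * α = 0 := by
      field_simp; ring
    calc a * b = (1 : k) • (a * b) + (0 : k) • (b * a) := by simp
      _ = _ := by rw [← e₁, ← e₂]; module

/-- Conjugation of a homomorphism by twisted homomorphisms with the same twist. -/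
theorem conj {D : Type*} [NonUnitalNonAssocRing D] [Module k D] {s : A ≃ B} {t : C ≃ D}
    (hs : IsTwist φ α β s) (ht : IsTwist φ α β t) (h₁ : α ≠ β) (h₂ : α ≠ -β) (f : A →ₙₐ[k] C) :
    IsTwist (k := k) 1 1 0 (fun b => t (f (s.symm b))) := by
  have h := sq_sub_sq_ne_zero h₁ h₂
  have hφ : ∀ c, φ (φ⁻¹ c) = c := φ.apply_symm_apply
  refine ((ht.comp (of_algHom f)).comp (hs.symm h₁ h₂)).congr ?_ ?_ ?_
  · simp
  · simp; field_simp; ring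
  · simp; field_simp; ring

/-- Injectivity of `t` reduces each identity to one between images under `t`, so nondegeneracy need
not be assumed. -/
theorem conj_symm {D : Type*} [NonUnitalNonAssocRing D] [Module k D] {s : A → B} {t : C ≃ D}
    (hs : IsTwist φ α β s) (ht : IsTwist φ α β t) (f : B →ₙₐ[k] D) :
    IsTwist (k := k) 1 1 0 (fun a => t.symm (f (s a))) where
  map_add a b := t.injective (by simp [hs.map_add, ht.map_add])
  map_smul c a := t.injective (by simp [hs.map_smul, ht.map_smul])
  map_mul a b := t.injective (by simp [hs.map_mul, ht.map_mul])

theorem ext_of {X : Type*} {s t : FreePA k X → A} (hs : IsTwist φ α β s) (ht : IsTwist φ α β t)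
    (h : ∀ x, s (FreePA.of k x) = t (FreePA.of k x)) : s = t := by
  funext a
  induction a using FreePA.induction with
  | of x => exact h x
  | zero => rw [hs.map_zero, ht.map_zero]
  | add a b ha hb => rw [hs.map_add, ht.map_add, ha, hb]
  | smul c a ha => rw [hs.map_smul, ht.map_smul, ha]
  | mul a b ha hb => rw [hs.map_mul, ht.map_mul, ha, hb]

end IsTwist

/-! ### Twisted algebras and twisted automorphisms of free algebras -/

/-- The algebra `A` with the action of the scalars twisted by `φ` and the multiplication replaced
by `α a b + β b a`. -/
def Twisted (_φ : RingAut k) (_α _β : k) (A : Type v) : Type v := A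

namespace Twisted

section

variable (φ : RingAut k) (α β : k) (A : Type v) [NonUnitalNonAssocRing A]

/-- The identity map. -/
def up : A ≃ Twisted φ α β A := Equiv.refl A

instance : AddCommGroup (Twisted φ α β A) := inferInstanceAs (AddCommGroup A)

theorem up_add (a b : A) : up φ α β A (a + b) = up φ α β A a + up φ α β A b := rfl

theorem up_zero : up φ α β A 0 = 0 := rfl

end

variable {φ : RingAut k} {α β : k} {A : Type v} [NonUnitalNonAssocRing A] [Module k A]

instance : Module k (Twisted φ α β A) := Module.compHom A (φ : k ≃+* k).toRingHom

instance : Mul (Twisted φ α β A) where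
  mul a b := up φ α β A (α • ((up φ α β A).symm a * (up φ α β A).symm b) +
    β • ((up φ α β A).symm b * (up φ α β A).symm a))

theorem smul_up (c : k) (a : A) : c • up φ α β A a = up φ α β A (φ c • a) := rfl

theorem up_mul_up (a b : A) :
    up φ α β A a * up φ α β A b = up φ α β A (α • (a * b) + β • (b * a)) := rfl

instance : NonUnitalNonAssocRing (Twisted φ α β A) where
  left_distrib a b c := by
    obtain ⟨a, rfl⟩ := (up φ α β A).surjective a
    obtain ⟨b, rfl⟩ := (up φ α β A).surjective b
    obtain ⟨c, rfl⟩ := (up φ α β A).surjective c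
    simp only [← up_add, up_mul_up, mul_add, add_mul, smul_add]
    congr 1; abel
  right_distrib a b c := by
    obtain ⟨a, rfl⟩ := (up φ α β A).surjective a
    obtain ⟨b, rfl⟩ := (up φ α β A).surjective b
    obtain ⟨c, rfl⟩ := (up φ α β A).surjective c
    simp only [← up_add, up_mul_up, mul_add, add_mul, smul_add]
    congr 1; abel
  zero_mul a := by
    obtain ⟨a, rfl⟩ := (up φ α β A).surjective a
    simp [← up_zero, up_mul_up]
  mul_zero a := by
    obtain ⟨a, rfl⟩ := (up φ α β A).surjective a
    simp [← up_zero, up_mul_up]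

variable [IsScalarTower k A A] [SMulCommClass k A A]

instance : IsScalarTower k (Twisted φ α β A) (Twisted φ α β A) where
  smul_assoc c a b := by
    obtain ⟨a, rfl⟩ := (up φ α β A).surjective a
    obtain ⟨b, rfl⟩ := (up φ α β A).surjective b
    simp only [smul_eq_mul, smul_up, up_mul_up, smul_mul_assoc, mul_smul_comm, smul_add]
    simp only [smul_smul, mul_comm]

instance : SMulCommClass k (Twisted φ α β A) (Twisted φ α β A) where
  smul_comm c a b := by
    obtain ⟨a, rfl⟩ := (up φ α β A).surjective a
    obtain ⟨b, rfl⟩ := (up φ α β A).surjective b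
    simp only [smul_eq_mul, smul_up, up_mul_up, smul_mul_assoc, mul_smul_comm, smul_add]
    simp only [smul_smul, mul_comm]

/-- Powers of a single element commute, so each twisted product of two of them is the old one times
`α + β`, and a monomial of length `n` contains `n - 1` products. The truncated subtraction is
harmless because lengths are positive. -/
theorem monomialEval_up [IsPowerAssociative A] (t : FreeMagma Unit) (a : A) :
    monomialEval t (up φ α β A a) = up φ α β A ((α + β) ^ (t.length - 1) • monomialEval t a) := by
  induction t with
  | ih1 x => simp [monomialEval]
  | ih2 x y hx hy =>
    have hm : ∀ {B : Type v} [Mul B] (x y : FreeMagma Unit) (b : B),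
      monomialEval (x * y) b = monomialEval x b * monomialEval y b := fun x y b => map_mul _ x y
    have hc : monomialEval y a * monomialEval x a = monomialEval x a * monomialEval y a := by
      rw [← hm, ← hm]
      exact IsPowerAssociative.monomialEval_eq _ _ (Nat.add_comm _ _) _
    have hl : (x * y).length - 1 = (x.length - 1) + (y.length - 1) + 1 := by
      have h1 := x.length_pos
      have h2 := y.length_pos
      have h3 : (x * y).length = x.length + y.length := rfl
      omega
    rw [hm, hx, hy, hl, up_mul_up, hm]
    congr 1
    simp only [smul_mul_assoc, mul_smul_comm, hc]
    module

instance [IsPowerAssociative A] : IsPowerAssociative (Twisted φ α β A) where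
  monomialEval_eq s t h a := by
    obtain ⟨a, rfl⟩ := (up φ α β A).surjective a
    rw [monomialEval_up, monomialEval_up, h, IsPowerAssociative.monomialEval_eq s t h a]

end Twisted

/-- The twisted endomorphism of a free algebra that fixes the generators. -/
def twistMap (φ : RingAut k) (α β : k) (X : Type v) (a : FreePA k X) : FreePA k X :=
  (Twisted.up φ α β (FreePA k X)).symm
    (FreePA.lift k (fun x => Twisted.up φ α β (FreePA k X) (FreePA.of k x)) a)

theorem isTwist_twistMap (φ : RingAut k) (α β : k) (X : Type v) :
    IsTwist φ α β (twistMap φ α β X) where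
  map_add a b := by simp only [twistMap, map_add]; rfl
  map_smul c a := by simp only [twistMap, map_smul]; rfl
  map_mul a b := by simp only [twistMap, map_mul]; rfl

@[simp]
theorem twistMap_of (φ : RingAut k) (α β : k) {X : Type v} (x : X) :
    twistMap φ α β X (FreePA.of k x) = FreePA.of k x := by
  simp [twistMap]

theorem isTwist_id {A : Type v} [NonUnitalNonAssocRing A] [Module k A] :
    IsTwist (k := k) 1 1 0 (id : A → A) :=
  IsTwist.of_algHom (NonUnitalAlgHom.id k A)

theorem twistMap_comp (φ φ' : RingAut k) (α β α' β' : k) (X : Type v) :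
    twistMap φ α β X ∘ twistMap φ' α' β' X =
      twistMap (φ * φ') (φ α' * α + φ β' * β) (φ α' * β + φ β' * α) X :=
  ((isTwist_twistMap φ α β X).comp (isTwist_twistMap φ' α' β' X)).ext_of
    (isTwist_twistMap _ _ _ X) fun x => by simp

theorem twistMap_one (X : Type v) : twistMap (1 : RingAut k) 1 0 X = id :=
  (isTwist_twistMap _ _ _ X).ext_of isTwist_id fun x => by simp

/-- The twisted automorphism of a free algebra that fixes the generators. -/
def twistEquiv (φ : RingAut k) (α β : k) (h₁ : α ≠ β) (h₂ : α ≠ -β) (X : Type v) :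
    FreePA k X ≃ FreePA k X :=
  have h := sq_sub_sq_ne_zero h₁ h₂
  { toFun := twistMap φ α β X
    invFun := twistMap φ⁻¹ (φ⁻¹ (α / (α ^ 2 - β ^ 2))) (φ⁻¹ (-β / (α ^ 2 - β ^ 2))) X
    left_inv := by
      refine congrFun (g := id) ?_
      rw [← twistMap_one]
      refine (twistMap_comp _ _ _ _ _ _ _).trans ?_
      congr 1
      · exact inv_mul_cancel φ
      · rw [← map_mul, ← map_mul, ← map_add, map_eq_one_iff _ φ⁻¹.injective]
        field_simp; ring
      · rw [← map_mul, ← map_mul, ← map_add, map_eq_zero_iff _ φ⁻¹.injective]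
        field_simp; ring
    right_inv := by
      have hφ : ∀ c, φ (φ⁻¹ c) = c := φ.apply_symm_apply
      refine congrFun (g := id) ?_
      rw [← twistMap_one]
      refine (twistMap_comp _ _ _ _ _ _ _).trans ?_
      congr 1
      · exact mul_inv_cancel φ
      · rw [hφ, hφ]; field_simp; ring
      · rw [hφ, hφ]; field_simp; ring }

theorem isTwist_twistEquiv (φ : RingAut k) (α β : k) (h₁ : α ≠ β) (h₂ : α ≠ -β) (X : Type v) :
    IsTwist φ α β (twistEquiv φ α β h₁ h₂ X) :=
  isTwist_twistMap φ α β X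

@[simp]
theorem twistEquiv_of (φ : RingAut k) (α β : k) (h₁ : α ≠ β) (h₂ : α ≠ -β) {X : Type v} (x : X) :
    twistEquiv φ α β h₁ h₂ X (FreePA.of k x) = FreePA.of k x :=
  twistMap_of φ α β x

end Twist

/-! ### Admissible systems of words -/

namespace WordSystem

variable {k : Type u} [Field k]

variable (k) in
/-- The generator of `F(x₁)`. -/
abbrev gen : F k {1} := FreePA.of k ⟨1, by simp⟩

variable (k) in
/-- The first generator of `F(x₁, x₂)`. -/
abbrev gen₁ : F k {1, 2} := FreePA.of k ⟨1, by simp⟩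

variable (k) in
/-- The second generator of `F(x₁, x₂)`. -/
abbrev gen₂ : F k {1, 2} := FreePA.of k ⟨2, by simp⟩

section Operations

variable {H : Type w} [NonUnitalNonAssocRing H] [Module k H] [IsScalarTower k H H]
  [SMulCommClass k H H]

theorem hom_ext_pair {f g : F k {1, 2} →ₙₐ[k] H} (h₁ : f (gen₁ k) = g (gen₁ k))
    (h₂ : f (gen₂ k) = g (gen₂ k)) : f = g := by
  refine FreePA.hom_ext ?_
  rintro ⟨i, hi⟩
  obtain rfl | rfl : i = 1 ∨ i = 2 := by simpa using hi
  exacts [h₁, h₂]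

theorem hom_ext_single {f g : F k {1} →ₙₐ[k] H} (h : f (gen k) = g (gen k)) : f = g := by
  refine FreePA.hom_ext ?_
  rintro ⟨i, hi⟩
  obtain rfl : i = 1 := by simpa using hi
  exact h

variable [IsPowerAssociative H]

/-- The homomorphism from `F(x₁, x₂)` with given values on the generators. -/
def pair (h₁ h₂ : H) : F k {1, 2} →ₙₐ[k] H :=
  FreePA.lift k (fun i => if i.1 = 1 then h₁ else h₂)

@[simp] theorem pair_gen₁ (h₁ h₂ : H) : pair h₁ h₂ (gen₁ k) = h₁ := by simp [pair]

@[simp] theorem pair_gen₂ (h₁ h₂ : H) : pair h₁ h₂ (gen₂ k) = h₂ := by simp [pair]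

theorem pair_gens (w : F k {1, 2}) : pair (gen₁ k) (gen₂ k) w = w :=
  DFunLike.congr_fun (hom_ext_pair (g := NonUnitalAlgHom.id k (F k {1, 2})) (by simp)
    (by simp)) w

theorem opAdd_eq (W : WordSystem k) (h₁ h₂ : H) : W.opAdd h₁ h₂ = pair h₁ h₂ W.add := rfl

theorem opMul_eq (W : WordSystem k) (h₁ h₂ : H) : W.opMul h₁ h₂ = pair h₁ h₂ W.mul := rfl

theorem opZero_eq (W : WordSystem k) : W.opZero H = 0 := by
  rw [opZero, Subsingleton.elim W.zero 0, map_zero]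

theorem lift_gen (w : F k {1}) : FreePA.lift k (fun _ => gen k) w = w :=
  DFunLike.congr_fun (hom_ext_single (g := NonUnitalAlgHom.id k (F k {1})) (by simp)) w

theorem isIsoToVerbal_standard {φ : RingAut k} {α β : k} {σ : H ≃ H} :
    (standard φ α β).IsIsoToVerbal σ ↔ IsTwist φ α β σ := by
  have h₁ : ∀ (c : k) (h : H), (standard φ α β).opSMul c h = φ c • h := by
    intro c h; simp [opSMul, standard]
  have h₂ : ∀ h₁ h₂ : H, (standard φ α β).opAdd h₁ h₂ = h₁ + h₂ := by
    intro h₁ h₂; rw [opAdd_eq, standard, map_add, pair_gen₁, pair_gen₂]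
  have h₃ : ∀ h₁ h₂ : H, (standard φ α β).opMul h₁ h₂ = α • (h₁ * h₂) + β • (h₂ * h₁) := by
    intro h₁ h₂
    rw [opMul_eq, standard]
    simp only [map_add, map_smul, map_mul, pair_gen₁, pair_gen₂]
  constructor
  · intro h
    exact ⟨fun a b => (h.map_add a b).trans (h₂ _ _), fun c a => (h.map_smul c a).trans (h₁ _ _),
      fun a b => (h.map_mul a b).trans (h₃ _ _)⟩
  · intro h
    exact ⟨by rw [h.map_zero, opZero_eq], fun c a => (h.map_smul c a).trans (h₁ _ _).symm,
      fun a b => (h.map_add a b).trans (h₂ _ _).symm,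
      fun a b => (h.map_mul a b).trans (h₃ _ _).symm⟩

end Operations

/-! ### Recovering the words from the isomorphisms -/

theorem smul_eq_of_iso {W : WordSystem k} {σ : F k {1} ≃ F k {1}} (hσ : W.IsIsoToVerbal σ)
    (hg : σ (gen k) = gen k) (c : k) : W.smul c = σ (c • gen k) := by
  rw [hσ.map_smul, hg, opSMul, lift_gen]

theorem add_eq_of_iso {W : WordSystem k} {σ : F k {1, 2} ≃ F k {1, 2}} (hσ : W.IsIsoToVerbal σ)
    (h₁ : σ (gen₁ k) = gen₁ k) (h₂ : σ (gen₂ k) = gen₂ k) : W.add = σ (gen₁ k + gen₂ k) := by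
  rw [hσ.map_add, h₁, h₂, opAdd_eq, pair_gens]

theorem mul_eq_of_iso {W : WordSystem k} {σ : F k {1, 2} ≃ F k {1, 2}} (hσ : W.IsIsoToVerbal σ)
    (h₁ : σ (gen₁ k) = gen₁ k) (h₂ : σ (gen₂ k) = gen₂ k) : W.mul = σ (gen₁ k * gen₂ k) := by
  rw [hσ.map_mul, h₁, h₂, opMul_eq, pair_gens]

theorem ext_words {W W' : WordSystem k} (h₁ : ∀ c, W.smul c = W'.smul c) (h₂ : W.add = W'.add)
    (h₃ : W.mul = W'.mul) : W = W' := by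
  cases W; cases W'
  simp only [mk.injEq]
  exact ⟨Subsingleton.elim _ _, funext h₁, h₂, h₃⟩

theorem gen_ne_zero : gen k ≠ 0 := by
  intro h
  have := congrArg (FreePA.toPoly k _) h
  simp [FreePA.toPoly] at this

theorem smul_gen_injective : Function.Injective fun c : k => c • gen k :=
  smul_left_injective k gen_ne_zero

/-- For `α = β` the twisted product is commutative and for `α = -β` anticommutative; pulling this
back along the injective `σ` would make `x₁ x₂` and `x₂ x₁` linearly dependent. -/
theorem nondegenerate_of_isTwist {φ : RingAut k} {α β : k} {σ : F k {1, 2} ≃ F k {1, 2}}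
    (hσ : IsTwist φ α β σ) : α ≠ β ∧ α ≠ -β := by
  have h12 : (⟨1, by simp⟩ : ({1, 2} : Finset ℕ)) ≠ ⟨2, by simp⟩ := by simp
  have key : ∀ c : k, σ (gen₁ k * gen₂ k) ≠ σ (c • (gen₂ k * gen₁ k)) := by
    intro c h
    have h' : (1 : k) • (gen₁ k * gen₂ k) + (-c) • (gen₂ k * gen₁ k) = 0 := by
      rw [σ.injective h]; module
    exact one_ne_zero (FreePA.smul_mul_add_smul_mul_eq_zero h12 h').1
  constructor
  · rintro rfl
    refine key 1 ?_
    rw [one_smul, hσ.map_mul, hσ.map_mul, add_comm]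
  · rintro rfl
    refine key (-1) ?_
    rw [hσ.map_smul, hσ.map_mul, hσ.map_mul, map_neg, map_one]
    module

theorem isAdmissible_standard (φ : RingAut k) {α β : k} (h₁ : α ≠ β) (h₂ : α ≠ -β) :
    (standard φ α β).IsAdmissible := fun X =>
  ⟨twistEquiv φ α β h₁ h₂ X, isIsoToVerbal_standard.2 (isTwist_twistEquiv φ α β h₁ h₂ X),
    fun x => twistEquiv_of φ α β h₁ h₂ x⟩

/-- Associativity of the scalar action says that the word for a product of scalars is a composite of
words. For `c ≠ 0` the word for `c⁻¹` thus inverts that for `c` under substitution, which leaves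
only multiples of the generator. -/
theorem IsAdmissible.exists_smul {W : WordSystem k} (hW : W.IsAdmissible) :
    ∃ φ : k →* k, Function.Injective φ ∧ φ 0 = 0 ∧ ∀ c, W.smul c = φ c • gen k := by
  obtain ⟨σ, hσ, hg⟩ := hW {1}
  have hg : σ (gen k) = gen k := hg _
  have hs := smul_eq_of_iso hσ hg
  have hcomp : ∀ c d : k, W.smul (c * d) = FreePA.lift k (fun _ => W.smul d) (W.smul c) := by
    intro c d
    rw [hs, mul_smul, hσ.map_smul, ← hs]
    rfl
  have hone : W.smul 1 = gen k := by rw [hs, one_smul, hg]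
  have hzero : W.smul 0 = 0 := by rw [hs, zero_smul, hσ.map_zero, opZero_eq]
  have hex : ∀ c, ∃ b : k, W.smul c = b • gen k := by
    intro c
    by_cases hc : c = 0
    · exact ⟨0, by rw [hc, hzero, zero_smul]⟩
    · refine FreePA.exists_eq_smul_of_lift_eq (q := W.smul c⁻¹) ?_
      rw [← hcomp, mul_inv_cancel₀ hc, hone]
      rfl
  choose f hf using hex
  refine ⟨⟨⟨f, smul_gen_injective ?_⟩, fun c d => smul_gen_injective ?_⟩, fun c d h => ?_,
    smul_gen_injective ?_, hf⟩
  · change f 1 • gen k = (1 : k) • gen k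
    rw [← hf, hone, one_smul]
  · change f (c * d) • gen k = (f c * f d) • gen k
    rw [← hf, hcomp, hf c, map_smul, FreePA.lift_of, hf d, smul_smul]
  · have h : f c = f d := h
    have h' : W.smul c = W.smul d := by rw [hf, hf, h]
    rw [hs, hs] at h'
    exact smul_gen_injective (σ.injective h')
  · change f 0 • gen k = (0 : k) • gen k
    rw [← hf, hzero, zero_smul]

/-- Injectivity reduces this to `2 ^ n = 2` in `k`, where characteristic zero enters. It allows `φ
2` to serve as the rescaling factor that separates degrees. -/
theorem pow_eq_self_of_injective [CharZero k] {φ : k →* k} (hφ : Function.Injective φ) (n : ℕ)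
    (h : φ 2 ^ n = φ 2) : n = 1 := by
  rw [← map_pow] at h
  have h' : ((2 ^ n : ℕ) : k) = ((2 ^ 1 : ℕ) : k) := by
    simpa using hφ h
  exact Nat.pow_right_injective le_rfl (Nat.cast_injective h')

theorem opSMul_of_eq {W : WordSystem k} {φ : k →* k} (hφ : ∀ c, W.smul c = φ c • gen k)
    {H : Type w} [NonUnitalNonAssocRing H] [Module k H] [IsScalarTower k H H]
    [SMulCommClass k H H] [IsPowerAssociative H] (c : k) (h : H) : W.opSMul c h = φ c • h := by
  rw [opSMul, hφ, map_smul, FreePA.lift_of]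

theorem span_image_univ {X : Type*} (w : FreePA k X) :
    w ∈ Submodule.span k (FreePA.mon k '' Set.univ) := by
  rw [Set.image_univ, FreePA.span_mon]
  trivial

theorem lift_eq_pair (f : ({1, 2} : Finset ℕ) → F k {1, 2}) :
    FreePA.lift k f = pair (f ⟨1, by simp⟩) (f ⟨2, by simp⟩) :=
  hom_ext_pair (by simp) (by simp)

theorem IsAdmissible.add_eq [CharZero k] {W : WordSystem k} (hW : W.IsAdmissible) :
    W.add = gen₁ k + gen₂ k := by
  obtain ⟨φ, hφ, -, hs⟩ := hW.exists_smul
  obtain ⟨σ, hσ, hg⟩ := hW {1, 2}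
  have hg₁ : σ (gen₁ k) = gen₁ k := hg _
  have hg₂ : σ (gen₂ k) = gen₂ k := hg _
  have hadd := add_eq_of_iso hσ hg₁ hg₂
  -- Applying `σ` to `2(x₁ + x₂) = 2x₁ + 2x₂` shows that rescaling both variables by `φ 2`
  -- multiplies the word by `φ 2`.
  have hw : W.add ∈ Submodule.span k {gen₁ k, gen₂ k} := by
    refine Submodule.span_mono ?_ (FreePA.mem_span_monDegree_eq_one
      (pow_eq_self_of_injective hφ) (fun _ => 1) Set.univ (span_image_univ W.add) ?_)
    · rintro _ ⟨t, ⟨-, ht⟩, rfl⟩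
      obtain ⟨⟨i, hi⟩, rfl⟩ := FreePA.exists_of_monDegree_one ht
      obtain rfl | rfl : i = 1 ∨ i = 2 := by simpa using hi
      · exact Or.inl rfl
      · exact Or.inr rfl
    · rw [lift_eq_pair, ← opAdd_eq, ← opSMul_of_eq hs, hadd, ← hσ.map_smul, smul_add, hσ.map_add,
        hσ.map_smul, hσ.map_smul, opSMul_of_eq hs, opSMul_of_eq hs, hg₁, hg₂, pow_one]
  obtain ⟨a, b, hab⟩ := Submodule.mem_span_pair.1 hw
  -- Neutrality of zero on either side forces both coefficients to be `1`.
  have ha := hσ.map_add (gen₁ k) 0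
  have hb := hσ.map_add 0 (gen₂ k)
  rw [add_zero, hσ.map_zero, opZero_eq, opAdd_eq, ← hab, map_add, map_smul, map_smul, pair_gen₁,
    pair_gen₂, smul_zero, add_zero, hg₁] at ha
  rw [zero_add, hσ.map_zero, opZero_eq, opAdd_eq, ← hab, map_add, map_smul, map_smul, pair_gen₁,
    pair_gen₂, smul_zero, zero_add, hg₂] at hb
  rw [← hab, ← ha, ← hb]

theorem mon_of_monDegree_eq_one {t : FreeMagma ({1, 2} : Finset ℕ)}
    (h₁ : FreePA.monDegree (fun i => if i.1 = 1 then 1 else 0) t = 1)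
    (h₂ : FreePA.monDegree (fun i => if i.1 = 1 then 0 else 1) t = 1) :
    FreePA.mon k t = gen₁ k * gen₂ k ∨ FreePA.mon k t = gen₂ k * gen₁ k := by
  have hd : ∀ t : FreeMagma ({1, 2} : Finset ℕ), FreePA.monDegree (fun _ => 1) t =
      FreePA.monDegree (fun i => if i.1 = 1 then 1 else 0) t +
        FreePA.monDegree (fun i => if i.1 = 1 then 0 else 1) t := by
    intro t
    induction t with
    | ih1 i => simp only [FreePA.monDegree]; split_ifs <;> rfl
    | ih2 s t hs ht => simp only [FreePA.monDegree_mul, hs, ht]; ring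
  have hpos : ∀ t : FreeMagma ({1, 2} : Finset ℕ), 0 < FreePA.monDegree (fun _ => 1) t := by
    intro t
    induction t with
    | ih1 x => exact one_pos
    | ih2 s t hs ht => rw [FreePA.monDegree_mul]; omega
  have h := hd t
  rw [h₁, h₂] at h
  cases t with
  | of x => simp [FreePA.monDegree] at h
  | mul s t =>
    have hs := hpos s
    have ht := hpos t
    simp only [FreePA.monDegree] at h
    obtain ⟨⟨i, hi⟩, rfl⟩ := FreePA.exists_of_monDegree_one (t := s) (by omega)
    obtain ⟨⟨j, hj⟩, rfl⟩ := FreePA.exists_of_monDegree_one (t := t) (by omega)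
    obtain rfl | rfl : i = 1 ∨ i = 2 := by simpa using hi
    · obtain rfl | rfl : j = 1 ∨ j = 2 := by simpa using hj
      · simp [FreePA.monDegree] at h₁
      · exact Or.inl rfl
    · obtain rfl | rfl : j = 1 ∨ j = 2 := by simpa using hj
      · exact Or.inr rfl
      · simp [FreePA.monDegree] at h₁

theorem IsAdmissible.exists_mul_eq [CharZero k] {W : WordSystem k} (hW : W.IsAdmissible) :
    ∃ α β : k, W.mul = α • (gen₁ k * gen₂ k) + β • (gen₂ k * gen₁ k) := by
  obtain ⟨φ, hφ, -, hs⟩ := hW.exists_smul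
  obtain ⟨σ, hσ, hg⟩ := hW {1, 2}
  have hg₁ : σ (gen₁ k) = gen₁ k := hg _
  have hg₂ : σ (gen₂ k) = gen₂ k := hg _
  have hmul := mul_eq_of_iso hσ hg₁ hg₂
  have ha := pow_eq_self_of_injective hφ
  -- Doubling only the first factor isolates degree one in `x₁`; doubling only the second does the
  -- same for `x₂`.
  have hw₁ := FreePA.mem_span_monDegree_eq_one ha (fun i => if i.1 = 1 then 1 else 0) Set.univ
    (span_image_univ W.mul) (by
      rw [lift_eq_pair, ← opMul_eq, ← opSMul_of_eq hs, hmul, ← hσ.map_smul, ← smul_mul_assoc,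
        hσ.map_mul, hσ.map_smul, opSMul_of_eq hs, hg₁, hg₂]
      simp)
  have hw₂ := FreePA.mem_span_monDegree_eq_one ha (fun i => if i.1 = 1 then 0 else 1) _ hw₁ (by
      rw [lift_eq_pair, ← opMul_eq, ← opSMul_of_eq hs, hmul, ← hσ.map_smul, ← mul_smul_comm,
        hσ.map_mul, hσ.map_smul, opSMul_of_eq hs, hg₁, hg₂]
      simp)
  have hw : W.mul ∈ Submodule.span k {gen₁ k * gen₂ k, gen₂ k * gen₁ k} := by
    refine Submodule.span_mono ?_ hw₂
    rintro _ ⟨t, ⟨⟨-, h₁⟩, h₂⟩, rfl⟩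
    exact mon_of_monDegree_eq_one h₁ h₂
  obtain ⟨α, β, h⟩ := Submodule.mem_span_pair.1 hw
  exact ⟨α, β, h.symm⟩

theorem IsAdmissible.exists_standard [CharZero k] {W : WordSystem k} (hW : W.IsAdmissible) :
    ∃ (φ : RingAut k) (α β : k), W = standard φ α β := by
  obtain ⟨φ, hφ, hφ0, hs⟩ := hW.exists_smul
  obtain ⟨α, β, hm⟩ := hW.exists_mul_eq
  obtain ⟨σ, hσ, hg⟩ := hW {1}
  have hg : σ (gen k) = gen k := hg _
  have hadd : ∀ a b : F k {1}, σ (a + b) = σ a + σ b := by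
    intro a b
    rw [hσ.map_add, opAdd_eq, hW.add_eq, map_add, pair_gen₁, pair_gen₂]
  have hsmul : ∀ (c : k) a, σ (c • a) = φ c • σ a := fun c a => by
    rw [hσ.map_smul, opSMul_of_eq hs]
  let f : k →+* k :=
    { φ with
      map_zero' := hφ0
      map_add' := fun c d => smul_gen_injective (by
        change φ (c + d) • gen k = (φ c + φ d) • gen k
        calc φ (c + d) • gen k = σ ((c + d) • gen k) := by rw [hsmul, hg]
          _ = _ := by rw [add_smul, hadd, hsmul, hsmul, hg, add_smul]) }
  -- Surjectivity of `φ` does not follow from surjectivity of `σ` on multiples of the generator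
  -- alone, since the preimage of `c x₁` might a priori be nonlinear. Its linear coefficient
  -- suffices: `σ` acts on linear coefficients by `f`, as products contribute nothing to them.
  have hcoeff : ∀ a : F k {1}, (FreePA.toPoly k _ (σ a)).coeff 1 =
      f ((FreePA.toPoly k _ a).coeff 1) := by
    intro a
    induction a using FreePA.induction with
    | of x =>
      obtain rfl : x = ⟨1, by simp⟩ := Subsingleton.elim _ _
      rw [hg]; simp [FreePA.toPoly]
    | zero => rw [hσ.map_zero, opZero_eq]; simp
    | add a b ha hb => rw [hadd]; simp [ha, hb]
    | smul c a ha =>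
      rw [hsmul]
      simp only [map_smul, Polynomial.coeff_smul, ha, smul_eq_mul, map_mul]
      rfl
    | mul a b ha hb =>
      rw [hσ.map_mul, opMul_eq, hm]
      simp [Polynomial.mul_coeff_one, FreePA.coeff_zero_toPoly]
  have hsurj : Function.Surjective f := by
    intro c
    obtain ⟨a, ha⟩ := σ.surjective (c • gen k)
    refine ⟨(FreePA.toPoly k _ a).coeff 1, ?_⟩
    rw [← hcoeff, ha]
    simp [FreePA.toPoly]
  exact ⟨RingEquiv.ofBijective f ⟨hφ, hsurj⟩, α, β, ext_words hs hW.add_eq hm⟩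

theorem isAdmissible_iff [CharZero k] (W : WordSystem k) : W.IsAdmissible ↔
    ∃ (φ : RingAut k) (α β : k), α ≠ β ∧ α ≠ -β ∧ W = standard φ α β := by
  constructor
  · intro hW
    obtain ⟨φ, α, β, rfl⟩ := hW.exists_standard
    obtain ⟨σ, hσ, -⟩ := hW {1, 2}
    have h := nondegenerate_of_isTwist (isIsoToVerbal_standard.1 hσ)
    exact ⟨φ, α, β, h.1, h.2, rfl⟩
  · rintro ⟨φ, α, β, h₁, h₂, rfl⟩
    exact isAdmissible_standard φ h₁ h₂

/-- A family of bijections that fix the generators and through which all homomorphisms are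
conjugated to homomorphisms is given by a system of words. -/
theorem exists_of_conj (s : ∀ X : Finset ℕ, F k X ≃ F k X)
    (hg : ∀ (X : Finset ℕ) (x : X), s X (FreePA.of k x) = FreePA.of k x)
    (hs : ∀ (X Y : Finset ℕ) (f : F k X →ₙₐ[k] F k Y), ∃ f' : F k X →ₙₐ[k] F k Y,
      ∀ a, f' a = s Y (f ((s X).symm a))) :
    ∃ W : WordSystem k, ∀ X, W.IsIsoToVerbal (s X) := by
  -- Since `s` fixes generators, the conjugate of a substitution is again a substitution, with
  -- values moved by `s`. Thus `s` carries each operation to the one defined by its value on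
  -- generators.
  have key : ∀ (X Y : Finset ℕ) (f : X → F k Y) (a : F k X),
      s Y (FreePA.lift k f a) = FreePA.lift k (fun x => s Y (f x)) (s X a) := by
    intro X Y f a
    obtain ⟨f', hf'⟩ := hs X Y (FreePA.lift k f)
    have h : f' = FreePA.lift k (fun x => s Y (f x)) := FreePA.hom_ext fun x => by
      rw [hf', ← hg X x, Equiv.symm_apply_apply, hg, FreePA.lift_of, FreePA.lift_of]
    rw [← h, hf', Equiv.symm_apply_apply]
  have key₂ : ∀ (Y : Finset ℕ) (a b : F k Y) (c : F k {1, 2}),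
      s Y (pair a b c) = pair (s Y a) (s Y b) (s {1, 2} c) := by
    intro Y a b c
    rw [pair, key]
    simp only [apply_ite (s Y)]
    rfl
  refine ⟨⟨0, fun c => s {1} (c • gen k), s {1, 2} (gen₁ k + gen₂ k),
    s {1, 2} (gen₁ k * gen₂ k)⟩, fun X => ⟨?_, fun c a => ?_, fun a b => ?_, fun a b => ?_⟩⟩
  · have h := key ∅ X (fun _ => 0) 0
    rw [map_zero (FreePA.lift k _), Subsingleton.elim (s ∅ 0) 0,
      map_zero (FreePA.lift k _)] at h
    rw [h, opZero_eq]
  · rw [opSMul, ← key, map_smul (FreePA.lift k _), FreePA.lift_of]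
  · rw [opAdd_eq, ← key₂, map_add (pair _ _), pair_gen₁, pair_gen₂]
  · rw [opMul_eq, ← key₂, map_mul (pair _ _), pair_gen₁, pair_gen₂]

end WordSystem

/-! ### Automorphisms of the category of free algebras -/

section Category

variable {k : Type u} [Field k]

section Generic

variable {C : Type v} [Category.{w} C] {G G' : C ⥤ C}

/-- Objects are fixed only up to propositional equality, so morphisms are compared after transport
to common endpoints. -/
theorem functor_ext_of_conj (h : ∀ A, G.obj A = A) (h' : ∀ A, G'.obj A = A)
    (hm : ∀ {A B : C} (f : A ⟶ B), eqToHom (h A).symm ≫ G.map f ≫ eqToHom (h B) =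
      eqToHom (h' A).symm ≫ G'.map f ≫ eqToHom (h' B)) : G = G' := by
  refine CategoryTheory.Functor.ext (fun A => (h A).trans (h' A).symm) fun A B f => ?_
  have e : G.map f = eqToHom (h A) ≫ (eqToHom (h A).symm ≫ G.map f ≫ eqToHom (h B)) ≫
      eqToHom (h B).symm := by simp
  rw [e, hm]
  simp

/-- A natural isomorphism from the identity to a functor that fixes all objects. -/
def natIsoOfFixed (h : ∀ A, G.obj A = A) (e : ∀ A : C, A ≅ A)
    (he : ∀ {A B : C} (f : A ⟶ B), f ≫ (e B).hom =
      (e A).hom ≫ eqToHom (h A).symm ≫ G.map f ≫ eqToHom (h B)) : 𝟭 C ≅ G :=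
  NatIso.ofComponents (fun A => e A ≪≫ eqToIso (h A).symm) fun {A B} f => by
    change f ≫ (e B).hom ≫ eqToHom (h B).symm =
      ((e A).hom ≫ eqToHom (h A).symm) ≫ G.map f
    rw [← Category.assoc, he]
    simp

/-- The components of a natural isomorphism from the identity to a functor that fixes all
objects, as automorphisms. -/
def fixedComponent (h : ∀ A, G.obj A = A) (i : 𝟭 C ≅ G) (A : C) : A ≅ A :=
  i.app A ≪≫ eqToIso (h A)

theorem fixedComponent_naturality (h : ∀ A, G.obj A = A) (i : 𝟭 C ≅ G) {A B : C} (f : A ⟶ B) :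
    (fixedComponent h i A).hom ≫ eqToHom (h A).symm ≫ G.map f ≫ eqToHom (h B) =
      f ≫ (fixedComponent h i B).hom := by
  have := i.hom.naturality f
  simp only [Functor.id_map] at this
  simp [fixedComponent, ← reassoc_of% this]

end Generic

/-- An algebra homomorphism as a morphism of `Θ⁰`. -/
def Theta0.ofAlgHom {A B : Theta0 k} (f : F k A.gens →ₙₐ[k] F k B.gens) : A ⟶ B := f

theorem Theta0.algHom_comp {A B C : Theta0 k} (f : A ⟶ B) (g : B ⟶ C) (a : F k A.gens) :
    algHom (f ≫ g) a = algHom g (algHom f a) := rfl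

theorem Theta0.hom_ext {A B : Theta0 k} {f g : A ⟶ B} (h : ∀ a, algHom f a = algHom g a) :
    f = g :=
  NonUnitalAlgHom.ext h

/-- A bijective homomorphism is an isomorphism of `Θ⁰`. -/
def Theta0.isoOfEquiv {A B : Theta0 k} (e : F k A.gens ≃ F k B.gens)
    (he : IsTwist (k := k) 1 1 0 e) : A ≅ B where
  hom := ofAlgHom he.toAlgHom
  inv := ofAlgHom (isTwist_id.conj_symm he (NonUnitalAlgHom.id k (F k B.gens))).toAlgHom
  hom_inv_id := hom_ext e.symm_apply_apply
  inv_hom_id := hom_ext e.apply_symm_apply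

/-- Conjugation by a family of bijections maps homomorphisms to homomorphisms. -/
abbrev ConjHom (s : ∀ X : Finset ℕ, F k X ≃ F k X) : Prop :=
  ∀ (X Y : Finset ℕ) (f : F k X →ₙₐ[k] F k Y),
    IsTwist (k := k) 1 1 0 (fun a => s Y (f ((s X).symm a)))

/-- The functor that acts on morphisms by conjugation by a family of bijections. -/
def conjFunctor (s : ∀ X : Finset ℕ, F k X ≃ F k X) (hs : ConjHom s) : Theta0 k ⥤ Theta0 k where
  obj A := A
  map f := Theta0.ofAlgHom (hs _ _ (Theta0.algHom f)).toAlgHom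
  map_id A := Theta0.hom_ext (s A.gens).apply_symm_apply
  map_comp {A B C} f g := Theta0.hom_ext fun a => by
    change s _ (Theta0.algHom g (Theta0.algHom f _)) =
      s _ (Theta0.algHom g ((s _).symm (s _ (Theta0.algHom f _))))
    rw [Equiv.symm_apply_apply]

theorem conjFunctor_comp {s t r : ∀ X : Finset ℕ, F k X ≃ F k X} (hs : ConjHom s) (ht : ConjHom t)
    (hr : ConjHom r) (h : ∀ X a, t X (s X a) = r X a) :
    conjFunctor s hs ⋙ conjFunctor t ht = conjFunctor r hr := by
  obtain rfl : r = fun X => (s X).trans (t X) :=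
    funext fun X => Equiv.ext fun a => (h X a).symm
  rfl

theorem conjFunctor_refl {r : ∀ X : Finset ℕ, F k X ≃ F k X}
    (hr : ConjHom r) (h : ∀ X a, r X a = a) : conjFunctor r hr = 𝟭 _ := by
  obtain rfl : r = fun X => Equiv.refl _ := funext fun X => Equiv.ext fun a => h X a
  rfl

theorem conjHom_refl : ConjHom fun X => Equiv.refl (F k X) := fun _ _ f => IsTwist.of_algHom f

/-- The automorphism of `Θ⁰` that acts on morphisms by conjugation by a family of bijections. -/
def conjAut (s : ∀ X : Finset ℕ, F k X ≃ F k X) (hs : ConjHom s)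
    (hs' : ConjHom fun X => (s X).symm) : Aut (Cat.of (Theta0 k)) where
  hom := (conjFunctor s hs).toCatHom
  inv := (conjFunctor _ hs').toCatHom
  hom_inv_id := Cat.ext ((conjFunctor_comp hs hs' conjHom_refl fun X a => by simp).trans
    (conjFunctor_refl _ fun _ _ => rfl))
  inv_hom_id := Cat.ext ((conjFunctor_comp hs' hs conjHom_refl fun X a => by simp).trans
    (conjFunctor_refl _ fun _ _ => rfl))

theorem actsBy_conjAut {s : ∀ X : Finset ℕ, F k X ≃ F k X} (hs : ConjHom s)
    (hs' : ConjHom fun X => (s X).symm)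
    (hg : ∀ (X : Finset ℕ) (x : X), s X (FreePA.of k x) = FreePA.of k x) :
    ActsBy (conjAut s hs hs') s where
  obj_eq _ := rfl
  map_eq _ _ _ _ := rfl
  gens_eq := hg

section Twist

variable {φ : RingAut k} {α β : k} {s : ∀ X : Finset ℕ, F k X ≃ F k X}

theorem conjHom_of_isTwist (hs : ∀ X, IsTwist φ α β (s X)) (h₁ : α ≠ β) (h₂ : α ≠ -β) :
    ConjHom s := fun X Y f => (hs X).conj (hs Y) h₁ h₂ f

theorem conjHom_symm_of_isTwist (hs : ∀ X, IsTwist φ α β (s X)) :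
    ConjHom fun X => (s X).symm := fun X Y f => (hs X).conj_symm (hs Y) f

end Twist

/-! ### Strongly stable automorphisms and their words -/

variable {Φ Ψ : Aut (Cat.of (Theta0 k))} {s t : ∀ X : Finset ℕ, F k X ≃ F k X}

theorem ActsBy.conj (h : ActsBy Φ s) (X Y : Finset ℕ) (f : F k X →ₙₐ[k] F k Y) :
    ∃ f' : F k X →ₙₐ[k] F k Y, ∀ a, f' a = s Y (f ((s X).symm a)) :=
  ⟨_, h.map_eq ⟨X⟩ ⟨Y⟩ f⟩

theorem ActsBy.conj_eq (hs : ActsBy Φ s) (ht : ActsBy Φ t) (X Y : Finset ℕ)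
    (f : F k X →ₙₐ[k] F k Y) (a : F k X) :
    s Y (f ((s X).symm a)) = t Y (f ((t X).symm a)) :=
  (hs.map_eq ⟨X⟩ ⟨Y⟩ f a).symm.trans (ht.map_eq ⟨X⟩ ⟨Y⟩ f a)

theorem ActsBy.bijections_eq (hs : ActsBy Φ s) (ht : ActsBy Φ t) : s = t := by
  funext X
  ext a
  -- Conjugating `x₁ ↦ a` and evaluating at `x₁` returns `s X a`, so the automorphism determines the
  -- bijections.
  have h := hs.conj_eq ht {1} X (FreePA.lift k fun _ => a) (WordSystem.gen k)
  rw [(Equiv.symm_apply_eq _).2 (hs.gens_eq _ _).symm,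
    (Equiv.symm_apply_eq _).2 (ht.gens_eq _ _).symm, FreePA.lift_of] at h
  exact h

theorem ActsBy.aut_eq (hs : ActsBy Φ s) (ht : ActsBy Ψ s) : Φ = Ψ := by
  refine Aut.ext (Cat.ext (functor_ext_of_conj hs.obj_eq ht.obj_eq fun {A B} f => ?_))
  exact Theta0.hom_ext fun a => (hs.map_eq A B f a).trans (ht.map_eq A B f a).symm

theorem existsUnique_wordSystem (hΦ : IsStronglyStable Φ) :
    ∃! W : WordSystem k, Corresponds Φ W := by
  obtain ⟨s, hs⟩ := hΦ
  obtain ⟨W, hW⟩ := WordSystem.exists_of_conj s hs.gens_eq hs.conj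
  refine ⟨W, ⟨s, hs, hW⟩, ?_⟩
  rintro W' ⟨t, ht, hW'⟩
  obtain rfl := hs.bijections_eq ht
  refine WordSystem.ext_words (fun c => ?_) ?_ ?_
  · rw [WordSystem.smul_eq_of_iso (hW _) (hs.gens_eq _ _),
      WordSystem.smul_eq_of_iso (hW' _) (hs.gens_eq _ _)]
  · rw [WordSystem.add_eq_of_iso (hW _) (hs.gens_eq _ _) (hs.gens_eq _ _),
      WordSystem.add_eq_of_iso (hW' _) (hs.gens_eq _ _) (hs.gens_eq _ _)]
  · rw [WordSystem.mul_eq_of_iso (hW _) (hs.gens_eq _ _) (hs.gens_eq _ _),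
      WordSystem.mul_eq_of_iso (hW' _) (hs.gens_eq _ _) (hs.gens_eq _ _)]

/-- The automorphism of `Θ⁰` given by a nondegenerate twist. -/
def twistAut (φ : RingAut k) (α β : k) (h₁ : α ≠ β) (h₂ : α ≠ -β) : Aut (Cat.of (Theta0 k)) :=
  conjAut (fun X => twistEquiv φ α β h₁ h₂ X)
    (conjHom_of_isTwist (fun X => isTwist_twistEquiv φ α β h₁ h₂ X) h₁ h₂)
    (conjHom_symm_of_isTwist fun X => isTwist_twistEquiv φ α β h₁ h₂ X)

theorem actsBy_twistAut (φ : RingAut k) (α β : k) (h₁ : α ≠ β) (h₂ : α ≠ -β) :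
    ActsBy (twistAut φ α β h₁ h₂) fun X => twistEquiv φ α β h₁ h₂ X :=
  actsBy_conjAut _ _ fun _ x => twistEquiv_of φ α β h₁ h₂ x

theorem existsUnique_aut [CharZero k] {W : WordSystem k} (hW : W.IsAdmissible) :
    ∃! Φ : Aut (Cat.of (Theta0 k)), Corresponds Φ W := by
  obtain ⟨φ, α, β, h₁, h₂, rfl⟩ := W.isAdmissible_iff.1 hW
  refine ⟨twistAut φ α β h₁ h₂, ⟨_, actsBy_twistAut φ α β h₁ h₂, fun X =>
    WordSystem.isIsoToVerbal_standard.2 (isTwist_twistEquiv φ α β h₁ h₂ X)⟩, ?_⟩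
  rintro Ψ ⟨t, ht, hW'⟩
  have h : t = fun X : Finset ℕ => twistEquiv φ α β h₁ h₂ X := by
    funext X
    refine DFunLike.coe_injective ((WordSystem.isIsoToVerbal_standard.1 (hW' X)).ext_of
      (isTwist_twistEquiv φ α β h₁ h₂ X) fun x => ?_)
    rw [ht.gens_eq, twistEquiv_of]
  subst h
  exact ht.aut_eq (actsBy_twistAut φ α β h₁ h₂)

/-! ### Inner automorphisms -/

theorem ActsBy.mem_innerAut (hs : ActsBy Φ s) (τ : ∀ X : Finset ℕ, F k X ≃ F k X)
    (hτ : ∀ X, IsTwist (k := k) 1 1 0 (τ X))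
    (h : ∀ (X Y : Finset ℕ) (f : F k X →ₙₐ[k] F k Y) (a : F k X),
      s Y (f ((s X).symm (τ X a))) = τ Y (f a)) : Φ ∈ innerAut (Theta0 k) := by
  refine ⟨natIsoOfFixed hs.obj_eq (fun A => Theta0.isoOfEquiv (τ A.gens) (hτ A.gens)) ?_⟩
  intro A B f
  exact Theta0.hom_ext fun a =>
    ((hs.map_eq A B f _).trans (h A.gens B.gens (Theta0.algHom f) a)).symm

theorem ActsBy.exists_of_mem_innerAut (hs : ActsBy Φ s) (hΦ : Φ ∈ innerAut (Theta0 k)) :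
    ∃ τ : ∀ X : Finset ℕ, F k X ≃ F k X, (∀ X, IsTwist (k := k) 1 1 0 (τ X)) ∧
      ∀ (X Y : Finset ℕ) (f : F k X →ₙₐ[k] F k Y) (a : F k X),
        s Y (f ((s X).symm (τ X a))) = τ Y (f a) := by
  obtain ⟨i⟩ := hΦ
  let j : ∀ X : Finset ℕ, (⟨X⟩ : Theta0 k) ≅ ⟨X⟩ := fun X => fixedComponent hs.obj_eq i ⟨X⟩
  refine ⟨fun X => ⟨Theta0.algHom (j X).hom, Theta0.algHom (j X).inv,
    fun a => ?_, fun a => ?_⟩, fun X => IsTwist.of_algHom _, fun X Y f a => ?_⟩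
  · rw [← Theta0.algHom_comp, Iso.hom_inv_id]; rfl
  · rw [← Theta0.algHom_comp, Iso.inv_hom_id]; rfl
  · exact (hs.map_eq ⟨X⟩ ⟨Y⟩ f _).symm.trans (congrArg (fun g => Theta0.algHom g a)
      (fixedComponent_naturality hs.obj_eq i (Theta0.ofAlgHom (A := ⟨X⟩) (B := ⟨Y⟩) f)))

theorem gen_mul_gen_ne_zero : WordSystem.gen₁ k * WordSystem.gen₂ k ≠ 0 := by
  intro h
  have h12 : (⟨1, by simp⟩ : ({1, 2} : Finset ℕ)) ≠ ⟨2, by simp⟩ := by simp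
  refine one_ne_zero (FreePA.smul_mul_add_smul_mul_eq_zero (k := k) h12 (a := 1) (b := 0) ?_).1
  rw [h]; simp

theorem ActsBy.mem_innerAut_iff {φ : RingAut k} {α β : k} (hs : ActsBy Φ s)
    (ht : ∀ X, IsTwist φ α β (s X)) : Φ ∈ innerAut (Theta0 k) ↔ β = 0 ∧ φ = RingEquiv.refl k := by
  have h12 : (⟨1, by simp⟩ : ({1, 2} : Finset ℕ)) ≠ ⟨2, by simp⟩ := by simp
  constructor
  · intro hΦ
    obtain ⟨τ, hτ, h⟩ := hs.exists_of_mem_innerAut hΦ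
    have hc : ∀ (X Y : Finset ℕ) (f : F k X →ₙₐ[k] F k Y) (a : F k X),
        (s Y).symm (τ Y (f a)) = f ((s X).symm (τ X a)) := by
      intro X Y f a
      rw [← h, Equiv.symm_apply_apply]
    -- The family `s⁻¹ τ` commutes with every homomorphism, hence with `x₁ ↦ a`; it is therefore
    -- substitution into one fixed element.
    have hgen : ∀ (X : Finset ℕ) (a : F k X), (s X).symm (τ X a) =
        FreePA.lift k (fun _ => a) ((s {1}).symm (τ {1} (WordSystem.gen k))) := by
      intro X a
      rw [← hc, FreePA.lift_of]
    obtain ⟨γ, hγ⟩ : ∃ γ : k, (s {1}).symm (τ {1} (WordSystem.gen k)) = γ • WordSystem.gen k := by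
      refine FreePA.exists_eq_smul_of_lift_eq
        (q := (τ {1}).symm (s {1} (WordSystem.gen k))) ?_
      rw [← hgen, Equiv.apply_symm_apply, Equiv.symm_apply_apply]
      rfl
    have hτs : ∀ (X : Finset ℕ) (a : F k X), τ X a = φ γ • s X a := by
      intro X a
      rw [← (ht X).map_smul, ← Equiv.symm_apply_eq, hgen, hγ, map_smul, FreePA.lift_of]
    have hγ0 : φ γ ≠ 0 := by
      intro h0
      have h1 := hτs {1} ((τ {1}).symm (WordSystem.gen k))
      rw [h0, zero_smul, Equiv.apply_symm_apply] at h1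
      exact WordSystem.gen_ne_zero h1
    constructor
    · have h1 := (hτ {1, 2}).map_mul (WordSystem.gen₁ k) (WordSystem.gen₂ k)
      rw [one_smul, zero_smul, add_zero, hτs, hτs, hτs, (ht _).map_mul, hs.gens_eq, hs.gens_eq,
        smul_mul_smul_comm] at h1
      -- Both sides of multiplicativity of `τ = φ(γ) s` are expanded on `x₁ x₂`; the coefficient of
      -- `x₂ x₁` gives `β = 0`.
      have h2 : (φ γ * α - φ γ * φ γ) • (WordSystem.gen₁ k * WordSystem.gen₂ k) +
          (φ γ * β) • (WordSystem.gen₂ k * WordSystem.gen₁ k) = 0 := by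
        rw [sub_smul, ← h1]; module
      exact (mul_eq_zero.1 (FreePA.smul_mul_add_smul_mul_eq_zero h12 h2).2).resolve_left hγ0
    · ext c
      have h1 := (hτ {1}).map_smul c (WordSystem.gen k)
      rw [hτs, hτs, (ht _).map_smul, hs.gens_eq, smul_smul, smul_smul] at h1
      have h2 : φ γ * φ c = c * φ γ := WordSystem.smul_gen_injective h1
      rw [mul_comm c] at h2
      exact mul_left_cancel₀ hγ0 h2
  · rintro ⟨rfl, rfl⟩
    have hα : α ≠ 0 := by
      rintro rfl
      have h1 := (ht {1, 2}).map_mul (WordSystem.gen₁ k) (WordSystem.gen₂ k)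
      rw [zero_smul, zero_smul, add_zero, ← (ht _).map_zero] at h1
      exact gen_mul_gen_ne_zero ((s _).injective h1)
    -- The factor `α` turns `s` into a homomorphism: `α s(ab) = (α s(a))(α s(b))`. Scalars commute
    -- with homomorphisms, so naturality survives.
    let m : ∀ X : Finset ℕ, F k X ≃ F k X := fun X =>
      (LinearEquiv.smulOfNeZero k (F k X) α hα).toEquiv
    have hm : ∀ X a, m X a = α • a := fun _ _ => rfl
    have ht' : ∀ (X : Finset ℕ) (c : k) (a : F k X), s X (c • a) = c • s X a :=
      fun X => (ht X).map_smul
    refine hs.mem_innerAut (fun X => (s X).trans (m X)) (fun X => ⟨fun a b => ?_, fun c a => ?_,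
      fun a b => ?_⟩) fun X Y f a => ?_
    all_goals simp only [Equiv.trans_apply, hm]
    · rw [(ht X).map_add, smul_add]
    · rw [ht', smul_comm]; rfl
    · rw [(ht X).map_mul, smul_mul_smul_comm]; module
    · rw [← ht', Equiv.symm_apply_apply, map_smul, ht']

end Category

/-! ### The group of outer automorphisms -/

section Outer

variable {k : Type u} [Field k]

section Functor

variable {G : Theta0 k ⥤ Theta0 k}

theorem Theta0.id_ne_zero (A : Theta0 k) (hA : A.gens.Nonempty) :
    𝟙 A ≠ Theta0.ofAlgHom (0 : F k A.gens →ₙₐ[k] F k A.gens) := by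
  obtain ⟨x, hx⟩ := hA
  intro h
  have h1 : FreePA.of k (⟨x, hx⟩ : A.gens) = 0 :=
    congrArg (fun f => Theta0.algHom f (FreePA.of k ⟨x, hx⟩)) h
  have h2 := congrArg (FreePA.lift k (fun _ => (1 : k))) h1
  rw [FreePA.lift_of, map_zero] at h2
  exact one_ne_zero h2

theorem Theta0.hom_ext_of {A B : Theta0 k} {f g : A ⟶ B}
    (h : ∀ x, algHom f (FreePA.of k x) = algHom g (FreePA.of k x)) : f = g :=
  FreePA.hom_ext h

theorem Theta0.algHom_ofAlgHom_lift_of {A B : Theta0 k} (b : A.gens → F k B.gens) (x : A.gens) :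
    algHom (ofAlgHom (FreePA.lift k b) : A ⟶ B) (FreePA.of k x) = b x :=
  FreePA.lift_of _ _

/-- Rank zero is thereby a categorical property, preserved and reflected by full and faithful
endofunctors. -/
theorem Theta0.subsingleton_end_iff (A : Theta0 k) : Subsingleton (A ⟶ A) ↔ A.gens = ∅ := by
  constructor
  · intro h
    by_contra hA
    exact A.id_ne_zero (Finset.nonempty_iff_ne_empty.2 hA) (Subsingleton.elim _ _)
  · intro hA
    have : IsEmpty A.gens := by rw [hA]; infer_instance
    exact ⟨fun f g => hom_ext fun a => by
      rw [Subsingleton.elim (algHom f a) (algHom g a)]⟩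

/-- A full and faithful endofunctor of `Θ⁰` that is surjective on objects maps the free algebra of
rank one to a free algebra of rank one. -/
theorem exists_gens_obj_eq_singleton [G.Full] [G.Faithful] (hG : ∀ B, ∃ A, G.obj A = B) :
    ∃ y, (G.obj ⟨{1}⟩).gens = {y} := by
  have hend : ∀ A, (G.obj A).gens = ∅ ↔ A.gens = ∅ := by
    intro A
    rw [← Theta0.subsingleton_end_iff, ← Theta0.subsingleton_end_iff]
    exact (Equiv.ofBijective (G.map : (A ⟶ A) → _) ⟨G.map_injective, G.map_surjective⟩).subsingleton_congr.symm
  obtain ⟨A, hA⟩ := hG ⟨{1}⟩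
  have hne : A.gens.Nonempty := by
    rw [Finset.nonempty_iff_ne_empty, Ne, ← hend, hA]
    simp
  obtain ⟨x, hx⟩ := hne
  -- The rank one algebra is a retract of `A`, so its image under `G` embeds into `G.obj A`, which
  -- is commutative. A commutative free algebra has at most one generator.
  let i : (⟨{1}⟩ : Theta0 k) ⟶ A := Theta0.ofAlgHom (FreePA.lift k fun _ => FreePA.of k ⟨x, hx⟩)
  let r : A ⟶ (⟨{1}⟩ : Theta0 k) := Theta0.ofAlgHom (FreePA.lift k fun _ => WordSystem.gen k)
  have hir : i ≫ r = 𝟙 _ := by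
    refine Theta0.hom_ext_of fun z => ?_
    rw [Theta0.algHom_comp, Theta0.algHom_ofAlgHom_lift_of, Theta0.algHom_ofAlgHom_lift_of,
      Subsingleton.elim z ⟨1, by simp⟩]
    rfl
  have hinj : Function.Injective (Theta0.algHom (G.map i)) :=
    Function.LeftInverse.injective (g := Theta0.algHom (G.map r)) fun a => by
      rw [← Theta0.algHom_comp, ← G.map_comp, hir, G.map_id]; rfl
  have hcomm : ∀ a b : F k (G.obj A).gens, a * b = b * a := by
    rw [hA]; exact FreePA.mul_comm_of_unique
  have hcomm' : ∀ a b : F k (G.obj ⟨{1}⟩).gens, a * b = b * a := fun a b =>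
    hinj (by rw [map_mul, map_mul, hcomm])
  have hne' : (G.obj ⟨{1}⟩).gens.Nonempty := by
    rw [Finset.nonempty_iff_ne_empty, Ne, hend]
    simp
  obtain ⟨y, hy⟩ := hne'
  refine ⟨y, Finset.eq_singleton_iff_unique_mem.2 ⟨hy, fun z hz => ?_⟩⟩
  by_contra hzy
  have hne : (⟨z, hz⟩ : (G.obj ⟨{1}⟩).gens) ≠ ⟨y, hy⟩ := fun h => hzy (congrArg Subtype.val h)
  refine one_ne_zero (FreePA.smul_mul_add_smul_mul_eq_zero (k := k) hne (a := 1) (b := -1) ?_).1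
  rw [hcomm']; module

/-- Homomorphisms from a free algebra of rank one are determined by the value at the generator. -/
def evalEquiv (A B : Theta0 k) {x : A.gens} (hx : ∀ y, y = x) : (A ⟶ B) ≃ F k B.gens where
  toFun f := Theta0.algHom f (FreePA.of k x)
  invFun b := Theta0.ofAlgHom (FreePA.lift k fun _ => b)
  left_inv f := FreePA.hom_ext fun y => by
    rw [hx y]
    exact FreePA.lift_of _ _
  right_inv b := FreePA.lift_of _ _

/-- A full and faithful endofunctor of `Θ⁰` that is surjective on objects acts on morphisms by
conjugation by a family of bijections. -/
theorem exists_natural_bijections [G.Full] [G.Faithful] (hG : ∀ B, ∃ A, G.obj A = B) :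
    ∃ s : ∀ A : Theta0 k, F k A.gens ≃ F k (G.obj A).gens, ∀ (A B : Theta0 k) (f : A ⟶ B) a,
      Theta0.algHom (G.map f) (s A a) = s B (Theta0.algHom f a) := by
  obtain ⟨y, hy⟩ := exists_gens_obj_eq_singleton hG
  have hy' : y ∈ (G.obj ⟨{1}⟩).gens := by rw [hy]; simp
  have hx : ∀ z : (G.obj ⟨{1}⟩).gens, z = ⟨y, hy'⟩ := by
    rintro ⟨z, hz⟩
    rw [hy] at hz
    exact Subtype.ext (Finset.mem_singleton.1 hz)
  have h1 : ∀ z : ({1} : Finset ℕ), z = ⟨1, by simp⟩ := fun z => Subsingleton.elim _ _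
  refine ⟨fun A => (evalEquiv ⟨{1}⟩ A h1).symm.trans ((Equiv.ofBijective
    (G.map : ((⟨{1}⟩ : Theta0 k) ⟶ A) → _) ⟨G.map_injective, G.map_surjective⟩).trans (evalEquiv _ _ hx)), ?_⟩
  intro A B f a
  obtain ⟨g, rfl⟩ := (evalEquiv ⟨{1}⟩ A h1).surjective a
  have hf : Theta0.algHom f (evalEquiv ⟨{1}⟩ A h1 g) = evalEquiv ⟨{1}⟩ B h1 (g ≫ f) := rfl
  rw [hf]
  simp only [Equiv.trans_apply, Equiv.symm_apply_apply]
  exact (congrArg (fun p => Theta0.algHom p (FreePA.of k ⟨y, hy'⟩)) (G.map_comp g f)).symm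

/-- The images of the free generators under natural bijections are free generators. -/
theorem exists_isTwist_eq_of [G.Full] [G.Faithful] (hG : ∀ B, ∃ A, G.obj A = B)
    (s : ∀ A : Theta0 k, F k A.gens ≃ F k (G.obj A).gens)
    (hs : ∀ (A B : Theta0 k) (f : A ⟶ B) a,
      Theta0.algHom (G.map f) (s A a) = s B (Theta0.algHom f a)) (A : Theta0 k) :
    ∃ e : F k A.gens ≃ F k (G.obj A).gens, IsTwist (k := k) 1 1 0 e ∧
      ∀ x : A.gens, e (FreePA.of k x) = s A (FreePA.of k x) := by
  -- Existence and uniqueness of extensions from the generators of `A` are transported through `G`,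
  -- giving the elements `s A x` the universal property of free generators.
  have hex : ∀ (B : Theta0 k) (g : A.gens → F k B.gens), ∃ p : G.obj A ⟶ B,
      ∀ x, Theta0.algHom p (s A (FreePA.of k x)) = g x := by
    intro B g
    obtain ⟨Z, rfl⟩ := hG B
    refine ⟨G.map (Theta0.ofAlgHom (FreePA.lift k fun x => (s Z).symm (g x))), fun x => ?_⟩
    rw [hs, Theta0.algHom_ofAlgHom_lift_of, Equiv.apply_symm_apply]
  have huniq : ∀ p : G.obj A ⟶ G.obj A,
      (∀ x, Theta0.algHom p (s A (FreePA.of k x)) = s A (FreePA.of k x)) → p = 𝟙 _ := by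
    intro p hp
    obtain ⟨f, rfl⟩ := G.map_surjective p
    rw [← G.map_id]
    congr 1
    refine FreePA.hom_ext fun x => (s A).injective ?_
    exact (hs _ _ f _).symm.trans (hp x)
  obtain ⟨p, hp⟩ := hex A fun x => FreePA.of k x
  let h : F k A.gens →ₙₐ[k] F k (G.obj A).gens := FreePA.lift k fun x => s A (FreePA.of k x)
  have h₁ : ∀ a, Theta0.algHom p (h a) = a := by
    have : Theta0.ofAlgHom h ≫ p = 𝟙 A := Theta0.hom_ext_of fun x => by
      rw [Theta0.algHom_comp, Theta0.algHom_ofAlgHom_lift_of, hp]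
      rfl
    exact fun a => congrArg (fun f => Theta0.algHom f a) this
  have h₂ : ∀ a, h (Theta0.algHom p a) = a := by
    have : p ≫ Theta0.ofAlgHom h = 𝟙 _ := huniq _ fun x => by
      rw [Theta0.algHom_comp, hp, Theta0.algHom_ofAlgHom_lift_of]
    exact fun a => congrArg (fun f => Theta0.algHom f a) this
  exact ⟨⟨h, Theta0.algHom p, h₁, h₂⟩, IsTwist.of_algHom h, fun x => FreePA.lift_of _ _⟩

end Functor

variable [CharZero k]

section Normalized

variable (g : kˣ ⋊[autActionUnits k] RingAut k)

/-- The coefficient of `x₁ x₂` in the normalized twist with `α + β = γ` and `α - β = 1`. -/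
def normα : k := ((g.left : k) + 1) / 2

/-- The coefficient of `x₂ x₁` in the normalized twist with `α + β = γ` and `α - β = 1`. -/
def normβ : k := ((g.left : k) - 1) / 2

theorem normα_ne : normα g ≠ normβ g := by
  intro h
  have h1 : normα g - normβ g = 1 := by simp only [normα, normβ]; ring
  rw [h, sub_self] at h1
  exact zero_ne_one h1

theorem normα_ne_neg : normα g ≠ -normβ g := by
  intro h
  have h1 : normα g + normβ g = g.left := by simp only [normα, normβ]; ring
  rw [h, neg_add_cancel] at h1
  exact g.left.ne_zero h1.symm

/-- The bijections of the normalized twist. -/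
def normEquiv (X : Finset ℕ) : F k X ≃ F k X :=
  twistEquiv g.right (normα g) (normβ g) (normα_ne g) (normα_ne_neg g) X

theorem isTwist_normEquiv (X : Finset ℕ) :
    IsTwist g.right (normα g) (normβ g) (normEquiv g X) :=
  isTwist_twistEquiv _ _ _ _ _ _

theorem normEquiv_of (X : Finset ℕ) (x : X) : normEquiv g X (FreePA.of k x) = FreePA.of k x :=
  twistEquiv_of _ _ _ _ _ _

/-- The condition `α - β = 1` is stable under composition, while the sums `α + β` multiply with the
action of `g.right`. -/
theorem normEquiv_mul (g h : kˣ ⋊[autActionUnits k] RingAut k) (X : Finset ℕ) (a : F k X) :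
    normEquiv (g * h) X a = normEquiv g X (normEquiv h X a) := by
  have hleft : (((g * h).left : kˣ) : k) = (g.left : k) * g.right (h.left : k) := rfl
  have hcomp := (isTwist_normEquiv g X).comp (isTwist_normEquiv h X)
  refine congrFun (((isTwist_normEquiv (g * h) X).congr (φ' := g.right * h.right) rfl ?_ ?_).ext_of
    hcomp fun x => ?_) a
  · simp only [normα, normβ, hleft, map_div₀, map_add, map_sub, map_one, map_ofNat]
    ring
  · simp only [normα, normβ, hleft, map_div₀, map_add, map_sub, map_one, map_ofNat]
    ring
  · simp [normEquiv_of]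

theorem conjHom_normEquiv : ConjHom (normEquiv g) :=
  conjHom_of_isTwist (isTwist_normEquiv g) (normα_ne g) (normα_ne_neg g)

/-- The automorphism of `Θ⁰` given by the normalized twist. -/
def normAut : Aut (Cat.of (Theta0 k)) :=
  conjAut (normEquiv g) (conjHom_normEquiv g) (conjHom_symm_of_isTwist (isTwist_normEquiv g))

theorem actsBy_normAut : ActsBy (normAut g) (normEquiv g) := actsBy_conjAut _ _ (normEquiv_of g)

end Normalized

variable (k) in
/-- The homomorphism that maps a pair of a nonzero scalar and a field automorphism to the
automorphism given by the normalized twist. -/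
def normAutHom : kˣ ⋊[autActionUnits k] RingAut k →* Aut (Cat.of (Theta0 k)) :=
  MonoidHom.mk' normAut fun g h => by
    have h' := conjFunctor_comp (conjHom_normEquiv h) (conjHom_normEquiv g)
      (conjHom_normEquiv (g * h)) fun X a => (normEquiv_mul g h X a).symm
    exact Aut.ext (Cat.ext h'.symm)

theorem normAut_mem_innerAut_iff (g : kˣ ⋊[autActionUnits k] RingAut k) :
    normAut g ∈ innerAut (Theta0 k) ↔ g = 1 := by
  rw [(actsBy_normAut g).mem_innerAut_iff (isTwist_normEquiv g)]
  constructor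
  · rintro ⟨h₁, h₂⟩
    refine SemidirectProduct.ext (Units.ext ?_) h₂
    rw [normβ, div_eq_zero_iff, or_iff_left two_ne_zero, sub_eq_zero] at h₁
    exact h₁
  · rintro rfl
    exact ⟨by simp [normβ], rfl⟩

/-- Every automorphism of `Θ⁰` is isomorphic to one given by a normalized twist. -/
theorem exists_natIso_normAut {G : Theta0 k ⥤ Theta0 k} [G.Full] [G.Faithful]
    (hG : ∀ B, ∃ A, G.obj A = B) : ∃ g : kˣ ⋊[autActionUnits k] RingAut k,
      Nonempty (conjFunctor (normEquiv g) (conjHom_normEquiv g) ≅ G) := by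
  obtain ⟨s, hs⟩ := exists_natural_bijections hG
  choose e he hes using exists_isTwist_eq_of hG s hs
  -- Composing with the isomorphisms `e` makes the bijections fix the generators, so the
  -- classification of admissible words applies.
  let t : ∀ X : Finset ℕ, F k X ≃ F k X := fun X => (s ⟨X⟩).trans (e ⟨X⟩).symm
  have htgen : ∀ (X : Finset ℕ) (x : X), t X (FreePA.of k x) = FreePA.of k x := fun X x => by
    simp only [t, Equiv.trans_apply]
    rw [Equiv.symm_apply_eq]
    exact (hes ⟨X⟩ x).symm
  have het : ∀ (A : Theta0 k) (a : F k A.gens), e A (t A.gens a) = s A a := fun A a =>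
    (e A).apply_symm_apply _
  obtain ⟨W, hW⟩ := WordSystem.exists_of_conj t htgen fun X Y f => by
    refine ⟨((he ⟨X⟩).conj_symm (he ⟨Y⟩) (Theta0.algHom (G.map
      (Theta0.ofAlgHom (A := ⟨X⟩) (B := ⟨Y⟩) f)))).toAlgHom, fun a => ?_⟩
    obtain ⟨b, rfl⟩ := (t X).surjective a
    refine (Equiv.symm_apply_eq _).2 ?_
    rw [Equiv.symm_apply_apply, het ⟨X⟩, het ⟨Y⟩, hs]
    rfl
  obtain ⟨φ, α, β, h₁, h₂, rfl⟩ := W.isAdmissible_iff.1 fun X => ⟨t X, hW X, htgen X⟩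
  have ht := fun X => WordSystem.isIsoToVerbal_standard.1 (hW X)
  have hv : α - β ≠ 0 := sub_ne_zero.2 h₁
  have hu : α + β ≠ 0 := fun h => h₂ (eq_neg_of_add_eq_zero_left h)
  -- Dividing `α` and `β` by `α - β` makes their difference `1` and their sum this ratio.
  let g : kˣ ⋊[autActionUnits k] RingAut k := ⟨Units.mk0 ((α + β) / (α - β)) (div_ne_zero hu hv), φ⟩
  have hα : (α - β) * normα g = α := by
    simp only [normα, g, Units.val_mk0]; field_simp; ring
  have hβ : (α - β) * normβ g = β := by
    simp only [normβ, g, Units.val_mk0]; field_simp; ring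
  -- Rescaling the generators by `α - β` absorbs the normalization: `δ` after the normalized twist
  -- is `(α - β) t`, as both have the same twist and agree on generators. Then `e` after `δ`
  -- provides the natural isomorphism.
  let δ : ∀ X : Finset ℕ, F k X →ₙₐ[k] F k X := fun X =>
    FreePA.lift k fun x => (α - β) • FreePA.of k x
  let δ' : ∀ X : Finset ℕ, F k X →ₙₐ[k] F k X := fun X =>
    FreePA.lift k fun x => (α - β)⁻¹ • FreePA.of k x
  have hδ : ∀ X a, δ' X (δ X a) = a := fun X => DFunLike.congr_fun
    (f := (δ' X).comp (δ X)) (g := NonUnitalAlgHom.id k (F k X))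
    (FreePA.hom_ext fun x => by simp [δ, δ', smul_smul, mul_inv_cancel₀ hv])
  have hδ' : ∀ X a, δ X (δ' X a) = a := fun X => DFunLike.congr_fun
    (f := (δ X).comp (δ' X)) (g := NonUnitalAlgHom.id k (F k X))
    (FreePA.hom_ext fun x => by simp [δ, δ', smul_smul, inv_mul_cancel₀ hv])
  let d : ∀ X : Finset ℕ, F k X ≃ F k X := fun X => ⟨δ X, δ' X, hδ X, hδ' X⟩
  have hd : ∀ X, IsTwist (k := k) 1 1 0 (d X) := fun X => IsTwist.of_algHom (δ X)
  have hdt : ∀ X a, δ X (normEquiv g X a) = (α - β) • t X a := by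
    intro X a
    have hg := isTwist_normEquiv g X
    have h := IsTwist.ext_of (k := k) (φ := φ) (α := α) (β := β) (ht X)
      (t := fun a => (α - β)⁻¹ • δ X (normEquiv g X a)) ⟨fun a b => ?_, fun c a => ?_,
        fun a b => ?_⟩ fun x => ?_
    · rw [congrFun h a, smul_smul, mul_inv_cancel₀ hv, one_smul]
    · rw [hg.map_add, map_add, smul_add]
    · rw [hg.map_smul, map_smul, smul_comm]
    · rw [hg.map_mul, map_add, map_smul, map_smul, map_mul, map_mul, smul_mul_smul_comm,
        smul_mul_smul_comm, smul_add, smul_smul, smul_smul, smul_smul, smul_smul]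
      congr 2
      · calc (α - β)⁻¹ * normα g = (α - β) * normα g * ((α - β)⁻¹ * (α - β)⁻¹) := by field_simp
          _ = _ := by rw [hα]
      · calc (α - β)⁻¹ * normβ g = (α - β) * normβ g * ((α - β)⁻¹ * (α - β)⁻¹) := by field_simp
          _ = _ := by rw [hβ]
    · simp [htgen, normEquiv_of, δ, smul_smul, inv_mul_cancel₀ hv]
  refine ⟨g, ⟨NatIso.ofComponents (fun A => Theta0.isoOfEquiv (A := A) (B := G.obj A)
    ((d A.gens).trans (e A)) (((he A).comp (hd A.gens)).congr ?_ ?_ ?_)) fun {A B} f =>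
      Theta0.hom_ext fun a => ?_⟩⟩
  · simp
  · simp
  · simp
  · obtain ⟨b, rfl⟩ := (normEquiv g A.gens).surjective a
    have he' : ∀ (A : Theta0 k) (c : k) a, e A (c • a) = c • e A a := fun A => (he A).map_smul
    change e B (δ B.gens (normEquiv g B.gens (Theta0.algHom f ((normEquiv g A.gens).symm _)))) =
      Theta0.algHom (G.map f) (e A (δ A.gens _))
    rw [Equiv.symm_apply_apply, hdt, hdt, he', he', het, het, map_smul, hs]

variable (k) in
/-- The group of outer automorphisms of `Θ⁰` consists of the classes of the normalized twists. -/
theorem bijective_mk_normAutHom : Function.Bijective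
    ((QuotientGroup.mk' (innerAut (Theta0 k))).comp (normAutHom k)) := by
  constructor
  · rw [injective_iff_map_eq_one]
    intro g hg
    exact (normAut_mem_innerAut_iff g).1 ((QuotientGroup.eq_one_iff _).1 hg)
  · intro q
    obtain ⟨Φ, rfl⟩ := QuotientGroup.mk'_surjective _ q
    let G : Theta0 k ⥤ Theta0 k := Φ.hom.toFunctor
    let G' : Theta0 k ⥤ Theta0 k := Φ.inv.toFunctor
    have h₁ : G ⋙ G' = 𝟭 _ := congrArg Cat.Hom.toFunctor Φ.hom_inv_id
    have h₂ : G' ⋙ G = 𝟭 _ := congrArg Cat.Hom.toFunctor Φ.inv_hom_id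
    let E : Theta0 k ≌ Theta0 k :=
      CategoryTheory.Equivalence.mk G G' (eqToIso h₁.symm) (eqToIso h₂)
    have : G.Full := inferInstanceAs E.functor.Full
    have : G.Faithful := inferInstanceAs E.functor.Faithful
    obtain ⟨g, ⟨i⟩⟩ := exists_natIso_normAut (G := G) fun B => ⟨G'.obj B, Functor.congr_obj h₂ B⟩
    have h : (normAut g).hom.toFunctor ⋙ (normAut g).inv.toFunctor = 𝟭 _ :=
      congrArg Cat.Hom.toFunctor (normAut g).hom_inv_id
    -- Whiskering the isomorphism with the inverse of `normAut g` turns it into one from the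
    -- identity, as equality of cosets requires.
    exact ⟨g, QuotientGroup.eq.2
      ⟨eqToIso h.symm ≪≫ Functor.isoWhiskerRight i (normAut g).inv.toFunctor⟩⟩

end Outer

end PowAssoc

end

theorem mainTheorem1 (k : Type u) [Field k] [CharZero k] :
    Nonempty ((Aut (Cat.of (PowAssoc.Theta0 k)) ⧸ PowAssoc.innerAut (PowAssoc.Theta0 k)) ≃*
      (kˣ ⋊[PowAssoc.autActionUnits k] RingAut k)) ∧
    (∀ Φ : Aut (Cat.of (PowAssoc.Theta0 k)), PowAssoc.IsStronglyStable Φ →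
      ∃! W : PowAssoc.WordSystem k, PowAssoc.Corresponds Φ W) ∧
    (∀ W : PowAssoc.WordSystem k, W.IsAdmissible →
      ∃! Φ : Aut (Cat.of (PowAssoc.Theta0 k)), PowAssoc.Corresponds Φ W) ∧
    (∀ W : PowAssoc.WordSystem k, W.IsAdmissible ↔
      ∃ (φ : RingAut k) (α₁₂ α₂₁ : k), α₁₂ ≠ α₂₁ ∧ α₁₂ ≠ -α₂₁ ∧
        W = PowAssoc.WordSystem.standard φ α₁₂ α₂₁) ∧
    (∀ (Φ : Aut (Cat.of (PowAssoc.Theta0 k))) (φ : RingAut k) (α₁₂ α₂₁ : k),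
      PowAssoc.Corresponds Φ (PowAssoc.WordSystem.standard φ α₁₂ α₂₁) →
        (Φ ∈ PowAssoc.innerAut (PowAssoc.Theta0 k) ↔ α₂₁ = 0 ∧ φ = RingEquiv.refl k)) := by
  refine ⟨⟨(MulEquiv.ofBijective _ (PowAssoc.bijective_mk_normAutHom k)).symm⟩,
    fun Φ hΦ => PowAssoc.existsUnique_wordSystem hΦ, fun W hW => PowAssoc.existsUnique_aut hW,
    fun W => W.isAdmissible_iff, ?_⟩
  rintro Φ φ α β ⟨s, hs, hW⟩
  exact hs.mem_innerAut_iff fun X => PowAssoc.WordSystem.isIsoToVerbal_standard.1 (hW X)
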